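/- Let $\Omega\subset\mathbb R^2$ be an open set, $T>0$, $I_T=(0,T)$, $\mu>0$. Norms of vectors are Euclidean, norms of matrices are Frobenius, and $\boldsymbol L^p(\Omega)=L^p(\Omega;\mathbb R^2)$. Let $\boldsymbol H^1_0(\Omega)$ be the closure of $C_c^\infty(\Omega;\mathbb R^2)$ in the $H^1$ norm, $\boldsymbol V=\{\psi\in\boldsymbol H^1_0(\Omega):\operatorname{div}\psi=0\}$, and $\boldsymbol H=\{\psi\in\boldsymbol L^2(\Omega):\operatorname{div}\psi=0\text{ in }\Omega,\ \psi\cdot n=0\text{ on }\partial\Omega\}$ (understood weakly: $\int_\Omega\psi\cdot\nabla q\,dx=0$ for all $q\in H^1(\Omega)$), with $\|\psi\|_{\boldsymbol H}=\|\psi\|_{\boldsymbol L^2}$. Let $c_P,c_L>0$ be constants with $$\|v\|_{\boldsymbol L^2}\le c_P\|\nabla v\|_{\boldsymbol L^2},\qquad \|v\|_{\boldsymbol L^4}\le\sqrt{c_L}\,\|v\|_{\boldsymbol L^2}^{1/2}\|\nabla v\|_{\boldsymbol L^2}^{1/2}\qquad\text{for all } v\in\boldsymbol H^1_0(\Omega)$$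 (such constants exist, for example, if $\Omega$ is bounded). Let $\alpha:\mathbb R\to\mathbb R$ be nonnegative and Lipschitz with $\alpha(1)=0$ and $\alpha(-1)>0$, and let $\varphi\in H^1(\Omega)$ with $|\varphi|\le1$ a.e. in $\Omega$. Let $F\in L^2(I_T;\boldsymbol L^2(\Omega))$, $u_1,u_2\in L^4(I_T;\boldsymbol L^4(\Omega))$ and $\tilde u_0\in\boldsymbol H$, where for a.e. $t\in I_T$ the field $u_2(t)$ is divergence free in the sense of distributions on $\Omega$ and $u_1(t)$ has a weak gradient $\nabla u_1(t)\in L^2(\Omega;\mathbb R^{2\times2})$. Put $$a_\varphi(v,w)=\mu\int_\Omega\nabla v:\nabla w\,dx+\int_\Omega\alpha(\varphi)\,v\cdot w\,dx,\qquad b(u,v,w)=\int_\Omega[(u\cdot\nabla)v]\cdot w\,dx .$$ Let $\tilde u\in L^2(I_T;\boldsymbol V)$ with $\partial_t\tilde u\in L^2(I_T;\boldsymbol V^*)$ be a weak solution of the linearized system $$\partial_t\tilde u+\alpha(\varphi)\tilde u-\mu\Delta\tilde u+(\tilde u\cdot\nabla)u_1+(u_2\cdot\nabla)\tilde u+\nabla\tilde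 p=F,\quad \operatorname{div}\tilde u=0\ \text{ in }\Omega\times I_T,\quad \tilde u=0\ \text{ on }\partial\Omega\times I_T,\quad \tilde u(0)=\tilde u_0,$$ that is, for a.e. $t\in I_T$ and all $\psi\in\boldsymbol V$, $$\langle\partial_t\tilde u(t),\psi\rangle_{\boldsymbol V}+a_\varphi(\tilde u(t),\psi)+b(\tilde u(t),u_1(t),\psi)+b(u_2(t),\tilde u(t),\psi)=(F(t),\psi)_{\Omega},$$ and $\tilde u(t)\to\tilde u_0$ in $\boldsymbol L^2(\Omega)$ as $t\to0^+$ outside a null set of times. Suppose that there is $z\in L^2(I_T;\boldsymbol L^2(\Omega))$ with $\|\nabla u_1(t)\|_{\boldsymbol L^2}^2\le\|z(t)\|_{\boldsymbol L^2}^2$ for a.e. $t\in I_T$. Then $\tilde u$ has a representative in $C([0,T];\boldsymbol L^2(\Omega))$, again denoted $\tilde u$, with $\tilde u(0)=\tilde u_0$, and for all $t\in[0,T]$ $$\|\tilde u(t)\|_{\boldsymbol H}^2\le e^{A(t)}\|\tilde u_0\|_{\boldsymbol H}^2+\frac{2c_P^2}{\mu}\int_0^te^{A(t)-A(\tau)}\|F(\tau)\|_{\boldsymbol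 L^2}^2\,d\tau,\qquad A(t)=\frac{2c_L^2}{\mu}\int_0^t\|z(\tau)\|_{\boldsymbol L^2}^2\,d\tau-\frac{\mu}{c_P^2}\,t .$$ -/

import Mathlib

open MeasureTheory Set Filter Topology
open scoped ENNReal ContDiff

noncomputable section

namespace LinNS

/-- The plane with its Euclidean norm; points of the domain and values of vector fields. -/
abbrev E : Type := EuclideanSpace ℝ (Fin 2)

/-- `2 × 2` matrices with the Frobenius norm and inner product. -/
abbrev Mat : Type := EuclideanSpace ℝ (Fin 2 × Fin 2)

instance factOneLeFour : Fact ((1 : ℝ≥0∞) ≤ 4) := ⟨by norm_num⟩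

/-- `L²(Ω; ℝ²)`. -/
abbrev L2 (Ω : Set E) : Type := Lp E 2 (volume.restrict Ω)

/-- `L⁴(Ω; ℝ²)`. -/
abbrev L4 (Ω : Set E) : Type := Lp E 4 (volume.restrict Ω)

/-- `L²(Ω; ℝ^{2×2})`; its norm is the square root of the integral of `∑ i j, |G i j|²`. -/
abbrev L2Mat (Ω : Set E) : Type := Lp Mat 2 (volume.restrict Ω)

/-- Lebesgue measure on the time interval `(0,T)`; `f ∈ L^p(0,T;X)` is `MemLp f p (timeMeas T)`. -/
abbrev timeMeas (T : ℝ) : Measure ℝ := volume.restrict (Ioo 0 T)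

/-- Functions of class `C_c^∞(Ω; F)`. -/
def IsTest {D F : Type*} [NormedAddCommGroup D] [NormedSpace ℝ D] [NormedAddCommGroup F]
    [NormedSpace ℝ F] (Ω : Set D) (η : D → F) : Prop :=
  ContDiff ℝ ∞ η ∧ HasCompactSupport η ∧ tsupport η ⊆ Ω

/-- The classical partial derivative `∂_j η`. -/
def pd {F : Type*} [NormedAddCommGroup F] [NormedSpace ℝ F] (j : Fin 2) (η : E → F) (x : E) : F :=
  fderiv ℝ η x (EuclideanSpace.single j 1)

/-- The classical gradient of a vector field, with entries `(∇θ)_{ij} = ∂_j θ_i`. -/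
def grad (θ : E → E) (x : E) : Mat := WithLp.toLp 2 fun p => pd p.2 θ x p.1

/-- `g` is the weak partial derivative `∂_j f` on `Ω`. -/
def IsWeakPartial (Ω : Set E) (j : Fin 2) (f g : E → ℝ) : Prop :=
  ∀ η : E → ℝ, IsTest Ω η → ∫ x in Ω, f x * pd j η x = - ∫ x in Ω, g x * η x

/-- `G` is the weak gradient of the vector field `v` on `Ω`, `G_{ij} = ∂_j v_i`. -/
def IsWeakGrad (Ω : Set E) (v : E → E) (G : E → Mat) : Prop :=
  ∀ i j : Fin 2, IsWeakPartial Ω j (fun x => v x i) (fun x => G x (i, j))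

/-- `div v = 0` in the sense of distributions on `Ω`. -/
def IsDivFree (Ω : Set E) (v : E → E) : Prop :=
  ∀ η : E → ℝ, IsTest Ω η → ∫ x in Ω, ∑ j, v x j * pd j η x = 0

/-- `q ∈ H¹(Ω)` is a scalar function with weak partial derivatives `g j`. -/
def IsH1 (Ω : Set E) (q : E → ℝ) (g : Fin 2 → E → ℝ) : Prop :=
  MemLp q 2 (volume.restrict Ω) ∧
    ∀ j, MemLp (g j) 2 (volume.restrict Ω) ∧ IsWeakPartial Ω j q (g j)

/-- The admissible design functions: `φ ∈ H¹(Ω)` with `|φ| ≤ 1` a.e. -/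
def PhiAd (Ω : Set E) : Set (E → ℝ) :=
  {φ | (∃ g, IsH1 Ω φ g) ∧ ∀ᵐ x ∂(volume.restrict Ω), |φ x| ≤ 1}

/-- The solenoidal fields of `L²(Ω; ℝ²)` with vanishing normal component on `∂Ω`. Both conditions
are expressed weakly: `∫ ψ · ∇q = 0` for every `q ∈ H¹(Ω)`. -/
def IsH (Ω : Set E) (ψ : L2 Ω) : Prop :=
  ∀ q g, IsH1 Ω q g → ∫ x in Ω, ∑ j, ψ x j * g j x = 0

/-- Ambient Hilbert space of pairs `(v, ∇v)`, with `‖(v, G)‖² = ‖v‖² + ‖G‖²`. -/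
abbrev Pair (Ω : Set E) : Type := WithLp 2 (L2 Ω × L2Mat Ω)

lemma IsTest.add {D F : Type*} [NormedAddCommGroup D] [NormedSpace ℝ D] [NormedAddCommGroup F]
    [NormedSpace ℝ F] {Ω : Set D} {η θ : D → F} (h : IsTest Ω η) (k : IsTest Ω θ) :
    IsTest Ω (η + θ) :=
  ⟨h.1.add k.1, h.2.1.add k.2.1,
    (tsupport_add η θ).trans (union_subset h.2.2 k.2.2)⟩

lemma IsTest.smul {D F : Type*} [NormedAddCommGroup D] [NormedSpace ℝ D] [NormedAddCommGroup F]
    [NormedSpace ℝ F] {Ω : Set D} {η : D → F} (c : ℝ) (h : IsTest Ω η) :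
    IsTest Ω (c • η) := by
  have hs : Function.support (c • η) ⊆ Function.support η := by
    intro x hx hx0
    exact hx (by simp [hx0])
  exact ⟨h.1.const_smul c, h.2.1.mono hs, (closure_mono hs).trans h.2.2⟩

/-- The pairs `(θ, ∇θ)` with `θ ∈ C_c^∞(Ω; ℝ²)`. -/
def testPairs (Ω : Set E) : Submodule ℝ (Pair Ω) where
  carrier := {p | ∃ θ : E → E, IsTest Ω θ ∧ p.fst =ᵐ[volume.restrict Ω] θ ∧
    p.snd =ᵐ[volume.restrict Ω] grad θ}
  zero_mem' := by
    refine ⟨0, ⟨contDiff_const, HasCompactSupport.zero, by simp [tsupport]⟩, ?_, ?_⟩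
    · exact Lp.coeFn_zero _ _ _
    · filter_upwards [Lp.coeFn_zero Mat 2 (volume.restrict Ω)] with x hx
      rw [show ((0 : Pair Ω).snd) = 0 from rfl, hx]
      ext p
      simp [grad, pd]
  add_mem' := by
    rintro p q ⟨θ, hθ, h1, h2⟩ ⟨η, hη, k1, k2⟩
    refine ⟨θ + η, hθ.add hη, ?_, ?_⟩
    · filter_upwards [Lp.coeFn_add p.fst q.fst, h1, k1] with x hx a b
      rw [show (p + q).fst = p.fst + q.fst from rfl, hx]
      simp [a, b]
    · filter_upwards [Lp.coeFn_add p.snd q.snd, h2, k2] with x hx a b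
      have dθ : DifferentiableAt ℝ θ x := (hθ.1.differentiable (by simp)).differentiableAt
      have dη : DifferentiableAt ℝ η x := (hη.1.differentiable (by simp)).differentiableAt
      rw [show (p + q).snd = p.snd + q.snd from rfl, hx, Pi.add_apply, a, b]
      ext i
      simp [grad, pd, fderiv_add dθ dη]
  smul_mem' := by
    rintro c p ⟨θ, hθ, h1, h2⟩
    refine ⟨c • θ, hθ.smul c, ?_, ?_⟩
    · filter_upwards [Lp.coeFn_smul c p.fst, h1] with x hx a
      rw [show (c • p).fst = c • p.fst from rfl, hx]
      simp [a]
    · filter_upwards [Lp.coeFn_smul c p.snd, h2] with x hx a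
      have dθ : DifferentiableAt ℝ θ x := (hθ.1.differentiable (by simp)).differentiableAt
      rw [show (c • p).snd = c • p.snd from rfl, hx, Pi.smul_apply, a]
      ext i
      simp [grad, pd, fderiv_const_smul dθ]

/-- `H¹₀(Ω; ℝ²)`, the closure of `C_c^∞(Ω; ℝ²)` in the `H¹` norm. A field `v` is stored together
with its weak gradient, as the pair `(v, ∇v)`. -/
def H10 (Ω : Set E) : Submodule ℝ (Pair Ω) := (testPairs Ω).topologicalClosure

/-- The space of the fields in `H¹₀(Ω; ℝ²)` whose divergence `∑ i, ∂_i v_i` vanishes. It carries the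
`H¹` norm; under a Poincaré inequality this norm is equivalent to `v ↦ ‖∇v‖`, so that the dual space
and the spaces `L²(0,T;V)`, `L²(0,T;V*)` are the same for both norms. -/
def V (Ω : Set E) : Submodule ℝ (Pair Ω) where
  carrier := {p | p ∈ H10 Ω ∧ ∀ᵐ x ∂(volume.restrict Ω), ∑ i, p.snd x (i, i) = 0}
  zero_mem' := by
    refine ⟨zero_mem _, ?_⟩
    filter_upwards [Lp.coeFn_zero Mat 2 (volume.restrict Ω)] with x hx
    rw [show ((0 : Pair Ω).snd) = 0 from rfl, hx]
    simp
  add_mem' := by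
    rintro p q ⟨hp, h⟩ ⟨hq, k⟩
    refine ⟨add_mem hp hq, ?_⟩
    filter_upwards [Lp.coeFn_add p.snd q.snd, h, k] with x hx a b
    rw [show (p + q).snd = p.snd + q.snd from rfl, hx]
    simp only [Pi.add_apply, PiLp.add_apply, Finset.sum_add_distrib, a, b, add_zero]
  smul_mem' := by
    rintro c p ⟨hp, h⟩
    refine ⟨Submodule.smul_mem _ c hp, ?_⟩
    filter_upwards [Lp.coeFn_smul c p.snd, h] with x hx a
    rw [show (c • p).snd = c • p.snd from rfl, hx]
    simp only [Pi.smul_apply, PiLp.smul_apply, ← Finset.smul_sum, a, smul_zero]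

/-- The field underlying an element of `V`. -/
def fld {Ω : Set E} (v : V Ω) : L2 Ω := (v : Pair Ω).fst

/-- The gradient of an element of `V`. -/
def dfld {Ω : Set E} (v : V Ω) : L2Mat Ω := (v : Pair Ω).snd

/-- `c` is a Poincaré constant: `‖v‖_{L²} ≤ c ‖∇v‖_{L²}` on `H¹₀(Ω; ℝ²)`. -/
def IsPoincareConst (Ω : Set E) (c : ℝ) : Prop :=
  0 < c ∧ ∀ p ∈ H10 Ω, ‖p.fst‖ ≤ c * ‖p.snd‖

/-- `c` is a Ladyzhenskaya constant: `‖v‖_{L⁴} ≤ √c ‖v‖_{L²}^{1/2} ‖∇v‖_{L²}^{1/2}` on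
`H¹₀(Ω; ℝ²)`. -/
def IsLadyzhenskayaConst (Ω : Set E) (c : ℝ) : Prop :=
  0 < c ∧ ∀ p ∈ H10 Ω, eLpNorm p.fst 4 (volume.restrict Ω) ≤
    ENNReal.ofReal (√c * √‖p.fst‖ * √‖p.snd‖)

/-- The assumptions on the porosity function. -/
structure IsPorosity (α : ℝ → ℝ) : Prop where
  nonneg : ∀ s, 0 ≤ α s
  lipschitz : ∃ K, LipschitzWith K α
  one : α 1 = 0
  neg_one : 0 < α (-1)

/-- `a_φ(v,w) = μ ∫ ∇v : ∇w + ∫ α(φ) v · w`. -/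
def aForm (Ω : Set E) (μ : ℝ) (α : ℝ → ℝ) (φ : E → ℝ) (v w : V Ω) : ℝ :=
  μ * (∫ x in Ω, ∑ i, ∑ j, dfld v x (i, j) * dfld w x (i, j)) +
    ∫ x in Ω, α (φ x) * ∑ i, fld v x i * fld w x i

/-- `b(u,v,w) = ∫ [(u · ∇) v] · w = ∫ ∑ i j, u_j ∂_j v_i w_i`, where `G` stands for `∇v`. -/
def bForm (Ω : Set E) (u : E → E) (G : E → Mat) (w : E → E) : ℝ :=
  ∫ x in Ω, ∑ i, ∑ j, u x j * G x (i, j) * w x i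

/-- The `L²` inner product `(v,w)_Ω`. -/
def ip (Ω : Set E) (v w : E → E) : ℝ := ∫ x in Ω, ∑ i, v x i * w x i

/-- `u'` is the weak derivative of `u` on `(0,T)` as a function with values in `V*`, where `v ∈ V`
is identified with the functional `(v, ·)_Ω`. -/
def IsWeakTimeDeriv (Ω : Set E) (T : ℝ) (u : ℝ → V Ω) (u' : ℝ → (V Ω →L[ℝ] ℝ)) : Prop :=
  ∀ (ψ : V Ω) (η : ℝ → ℝ), IsTest (Ioo 0 T) η →
    ∫ t in Ioo 0 T, ip Ω (fld (u t)) (fld ψ) * deriv η t = - ∫ t in Ioo 0 T, u' t ψ * η t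

/-- `u ∈ L²(0,T;V)` with `∂_t u ∈ L²(0,T;V*)` is a weak solution, with initial value `u₀`, of
`∂_t u + α(φ) u - μ Δu + (u · ∇) u₁ + (u₂ · ∇) u + ∇p = F`, `div u = 0`, `u = 0` on `∂Ω`.
Here `G₁` stands for `∇u₁`. The initial condition says that `u(t) → u₀` in `L²` as `t → 0⁺` outside
a null set of times, i.e. that the representative of `u` that is continuous with values in `L²`
takes the value `u₀` at `0`. -/
def IsWeakSolution (Ω : Set E) (T μ : ℝ) (α : ℝ → ℝ) (φ : E → ℝ) (G₁ : ℝ → L2Mat Ω)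
    (u₂ : ℝ → L4 Ω) (F : ℝ → L2 Ω) (u₀ : L2 Ω) (u : ℝ → V Ω) : Prop :=
  MemLp u 2 (timeMeas T) ∧
  (∃ u' : ℝ → (V Ω →L[ℝ] ℝ), MemLp u' 2 (timeMeas T) ∧ IsWeakTimeDeriv Ω T u u' ∧
    ∀ᵐ t ∂(timeMeas T), ∀ ψ : V Ω,
      u' t ψ + aForm Ω μ α φ (u t) ψ + bForm Ω (fld (u t)) (G₁ t) (fld ψ)
        + bForm Ω (u₂ t) (dfld (u t)) (fld ψ) = ip Ω (F t) (fld ψ)) ∧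
  Tendsto (fun t => fld (u t)) (𝓝[>] 0 ⊓ ae volume) (𝓝 u₀)

/-- `A(t) = (2 c_L² / μ) ∫_0^t ‖z(τ)‖² dτ - (μ / c_P²) t`. -/
def expA {Ω : Set E} (μ cP cL : ℝ) (z : ℝ → L2 Ω) (t : ℝ) : ℝ :=
  2 * cL ^ 2 / μ * (∫ τ in (0 : ℝ)..t, ‖z τ‖ ^ 2) - μ / cP ^ 2 * t

end LinNS

end

/-!
Testing the equation with `u` itself gives the energy inequality: the transport term
`b(u₂, u, u)` vanishes because `u₂` is divergence free, and the other terms are absorbed into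
`μ ‖∇u‖²` by the Ladyzhenskaya, Poincaré and Young inequalities. Gronwall's inequality then gives
the estimate, once `u` is known to be continuous with values in `L²` and to satisfy the energy
identity. Both facts hold for every weak derivative relative to an embedding `ι : X →L[ℝ] H` of
Hilbert spaces. If `R` is a left inverse of `ι` then `u` has the weak derivative `R R† u'`; in
general the Landweber iteration provides operators that approximate such an `R`.
-/

noncomputable section

namespace LinNS

section AbsolutelyContinuous

variable {X Y : Type*} [NormedAddCommGroup X] [NormedAddCommGroup Y] {a b : ℝ}

lemma absolutelyContinuousOnInterval_of_dist_le {f : ℝ → X} {g : ℝ → Y} {K : ℝ}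
    (hg : AbsolutelyContinuousOnInterval g a b)
    (h : ∀ x ∈ uIcc a b, ∀ y ∈ uIcc a b, dist (f x) (f y) ≤ K * dist (g x) (g y)) :
    AbsolutelyContinuousOnInterval f a b := by
  refine squeeze_zero' (Eventually.of_forall fun I => Finset.sum_nonneg fun _ _ => dist_nonneg) ?_
    (by simpa only [mul_zero] using Tendsto.const_mul K hg)
  have hmem : ∀ᶠ I in AbsolutelyContinuousOnInterval.totalLengthFilter ⊓
      𝓟 (AbsolutelyContinuousOnInterval.disjWithin a b),
      I ∈ AbsolutelyContinuousOnInterval.disjWithin a b :=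
    mem_inf_of_right (mem_principal_self _)
  filter_upwards [hmem] with I hI
  rw [Finset.mul_sum]
  exact Finset.sum_le_sum fun i hi => h _ (hI.1 i hi).1 _ (hI.1 i hi).2

variable [NormedSpace ℝ X] [NormedSpace ℝ Y]

lemma absolutelyContinuousOnInterval_comp_of_contDiff {φ : X → Y} {f : ℝ → X}
    (hφ : ContDiff ℝ 1 φ) (hf : AbsolutelyContinuousOnInterval f a b) :
    AbsolutelyContinuousOnInterval (fun t => φ (f t)) a b := by
  obtain ⟨K, hK⟩ := hφ.locallyLipschitz.locallyLipschitzOn.exists_lipschitzOnWith_of_compact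
    (isCompact_uIcc.image_of_continuousOn hf.continuousOn)
  exact absolutelyContinuousOnInterval_of_dist_le hf fun x hx y hy =>
    hK.dist_le_mul _ (mem_image_of_mem f hx) _ (mem_image_of_mem f hy)

lemma absolutelyContinuousOnInterval_primitive {g : ℝ → X} (hg : IntervalIntegrable g volume a b) :
    AbsolutelyContinuousOnInterval (fun t => ∫ s in a..t, g s) a b := by
  have hsub : ∀ x ∈ uIcc a b, IntervalIntegrable g volume a x := fun x hx =>
    hg.mono_set (uIcc_subset_uIcc_left hx)
  refine absolutelyContinuousOnInterval_of_dist_le (K := 1)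
    (hg.norm.absolutelyContinuousOnInterval_intervalIntegral left_mem_uIcc) fun x hx y hy => ?_
  rw [dist_eq_norm, Real.dist_eq, one_mul,
    intervalIntegral.integral_interval_sub_left (hsub x hx) (hsub y hy),
    intervalIntegral.integral_interval_sub_left (hsub x hx).norm (hsub y hy).norm]
  exact intervalIntegral.norm_integral_le_abs_integral_norm

lemma integral_eq_sub_of_ae_hasDerivAt [CompleteSpace X] {f f' : ℝ → X}
    (hf : AbsolutelyContinuousOnInterval f a b)
    (hf' : ∀ᵐ t, t ∈ uIcc a b → HasDerivAt f (f' t) t) (hint : IntervalIntegrable f' volume a b) :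
    ∫ t in a..b, f' t = f b - f a := by
  obtain ⟨C, hC⟩ := (hf.sub (absolutelyContinuousOnInterval_primitive hint)
    ).const_of_ae_hasDerivAt_zero (by
      filter_upwards [hf', hint.ae_hasDerivAt_integral] with t h₁ h₂ ht
      simpa using (h₁ ht).sub (h₂ ht a left_mem_uIcc))
  have ha := hC a left_mem_uIcc
  have hb := hC b right_mem_uIcc
  simp only [Pi.sub_apply, intervalIntegral.integral_same, sub_zero] at ha hb
  rw [ha, ← hb, sub_sub_cancel]

end AbsolutelyContinuous

lemma intervalIntegrable_inner {H : Type*} [NormedAddCommGroup H] [InnerProductSpace ℝ H] {a b : ℝ}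
    {f g : ℝ → H} (hf : ContinuousOn f (uIcc a b)) (hg : IntervalIntegrable g volume a b) :
    IntervalIntegrable (fun t => inner ℝ (f t) (g t)) volume a b := by
  obtain ⟨C, hC⟩ := isCompact_uIcc.exists_bound_of_continuousOn hf
  rw [intervalIntegrable_iff] at hg ⊢
  have hfm : AEStronglyMeasurable f (volume.restrict (uIoc a b)) :=
    (hf.mono uIoc_subset_uIcc).aestronglyMeasurable measurableSet_uIoc
  refine (hg.norm.const_mul C).mono' (hfm.inner hg.aestronglyMeasurable) ?_
  filter_upwards [ae_restrict_mem measurableSet_uIoc] with t ht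
  exact (norm_inner_le_norm _ _).trans
    (mul_le_mul_of_nonneg_right (hC t (uIoc_subset_uIcc ht)) (norm_nonneg _))

lemma norm_sq_add_integral {H : Type*} [NormedAddCommGroup H] [InnerProductSpace ℝ H]
    [CompleteSpace H] {a b : ℝ} {f : ℝ → H} (hf : IntervalIntegrable f volume a b) (c : H) :
    ‖c + ∫ t in a..b, f t‖ ^ 2
      = ‖c‖ ^ 2 + 2 * ∫ t in a..b, inner ℝ (c + ∫ s in a..t, f s) (f t) := by
  have hprim : AbsolutelyContinuousOnInterval (fun t => c + ∫ s in a..t, f s) a b :=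
    (contDiffOn_const (c := c)).absolutelyContinuousOnInterval.add
      (absolutelyContinuousOnInterval_primitive hf)
  have hint : IntervalIntegrable (fun t => inner ℝ (c + ∫ s in a..t, f s) (f t)) volume a b :=
    intervalIntegrable_inner hprim.continuousOn hf
  have hFTC := integral_eq_sub_of_ae_hasDerivAt
    (absolutelyContinuousOnInterval_comp_of_contDiff (contDiff_norm_sq ℝ) hprim)
    (f' := fun t => 2 * inner ℝ (c + ∫ s in a..t, f s) (f t)) (by
      filter_upwards [hf.ae_hasDerivAt_integral] with t h ht
      exact ((h ht a left_mem_uIcc).const_add c).norm_sq) (hint.const_mul 2)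
  rw [intervalIntegral.integral_const_mul] at hFTC
  simp only [intervalIntegral.integral_same, add_zero] at hFTC
  linarith

section WeakDerivative

lemma IsTest.deriv {s : Set ℝ} {η : ℝ → ℝ} (hη : IsTest s η) : IsTest s (deriv η) :=
  ⟨contDiff_infty_iff_deriv.1 hη.1 |>.2, hη.2.1.deriv, tsupport_deriv_subset.trans hη.2.2⟩

lemma IsTest.eq_zero_of_notMem {D F : Type*} [NormedAddCommGroup D] [NormedSpace ℝ D]
    [NormedAddCommGroup F] [NormedSpace ℝ F] {Ω : Set D} {η : D → F} (hη : IsTest Ω η) {x : D}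
    (hx : x ∉ Ω) : η x = 0 :=
  image_eq_zero_of_notMem_tsupport fun h => hx (hη.2.2 h)

variable {X : Type*} [NormedAddCommGroup X] [NormedSpace ℝ X]

lemma IsTest.integrable_smul {D : Type*} [NormedAddCommGroup D] [NormedSpace ℝ D]
    [MeasurableSpace D] [OpensMeasurableSpace D] {μ : Measure D} {Ω : Set D} {η : D → ℝ}
    (hη : IsTest Ω η) {f : D → X} (hf : Integrable f μ) : Integrable (fun x => η x • f x) μ := by
  obtain ⟨C, hC⟩ := hη.1.continuous.bounded_above_of_compact_support hη.2.1
  exact hf.bdd_smul C hη.1.continuous.aestronglyMeasurable (Eventually.of_forall hC)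

lemma IsTest.setIntegral_smul {D : Type*} [NormedAddCommGroup D] [NormedSpace ℝ D]
    [MeasurableSpace D] {μ : Measure D} {Ω : Set D} {η : D → ℝ} (hη : IsTest Ω η) (f : D → X) :
    ∫ x in Ω, η x • f x ∂μ = ∫ x, η x • f x ∂μ :=
  setIntegral_eq_integral_of_forall_compl_eq_zero fun x hx => by
    rw [hη.eq_zero_of_notMem hx, zero_smul]

lemma ae_eq_zero_of_forall_isTest [CompleteSpace X] {D : Type*} [NormedAddCommGroup D]
    [NormedSpace ℝ D] [FiniteDimensional ℝ D] [MeasurableSpace D] [BorelSpace D] {μ : Measure D}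
    {Ω : Set D} (hΩ : IsOpen Ω) {f : D → X} (hf : IntegrableOn f Ω μ)
    (h : ∀ η : D → ℝ, IsTest Ω η → ∫ x in Ω, η x • f x ∂μ = 0) :
    ∀ᵐ x ∂μ.restrict Ω, f x = 0 :=
  (ae_restrict_iff' hΩ.measurableSet).2 <|
    hΩ.ae_eq_zero_of_integral_contDiff_smul_eq_zero hf.locallyIntegrableOn fun η h₁ h₂ h₃ =>
      (IsTest.setIntegral_smul ⟨h₁, h₂, h₃⟩ f).symm.trans (h η ⟨h₁, h₂, h₃⟩)

variable {a b : ℝ}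

lemma exists_isTest_deriv_eq {η : ℝ → ℝ} (hη : IsTest (Ioo a b) η) (hη₀ : ∫ t, η t = 0) :
    ∃ ζ : ℝ → ℝ, IsTest (Ioo a b) ζ ∧ deriv ζ = η := by
  rcases (tsupport η).eq_empty_or_nonempty with hempty | hne
  · refine ⟨0, ⟨contDiff_const, HasCompactSupport.zero, by simp [tsupport]⟩, ?_⟩
    rw [tsupport_eq_empty_iff.1 hempty]
    exact deriv_zero
  obtain ⟨c, hc⟩ := hη.2.1.isCompact.exists_isLeast hne
  obtain ⟨d, hd⟩ := hη.2.1.isCompact.exists_isGreatest hne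
  have hη_supp : ∀ s, s ∉ Icc c d → η s = 0 := fun s hs =>
    image_eq_zero_of_notMem_tsupport fun h => hs ⟨hc.2 h, hd.2 h⟩
  have hac : a < c := (hη.2.2 hc.1).1
  set ζ : ℝ → ℝ := fun t => ∫ s in a..t, η s
  have hderiv : ∀ t, HasDerivAt ζ (η t) t := fun t =>
    (hη.1.continuous.integral_hasStrictDerivAt a t).hasDerivAt
  have hζ_deriv : deriv ζ = η := funext fun t => (hderiv t).deriv
  have hsupp : tsupport ζ ⊆ Icc c d := by
    refine closure_minimal (Function.support_subset_iff'.2 fun t ht => ?_) isClosed_Icc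
    rcases lt_or_ge t c with htc | hct
    · refine intervalIntegral.integral_zero_ae (Eventually.of_forall fun s hs => hη_supp s ?_)
      exact fun h => (hs.2.trans_lt (max_lt hac htc)).not_ge h.1
    · have hdt : d < t := not_le.1 fun h => ht ⟨hct, h⟩
      exact (intervalIntegral.integral_eq_integral_of_support_subset
        (Function.support_subset_iff'.2 fun s hs =>
          hη_supp s fun h => hs ⟨hac.trans_le h.1, h.2.trans hdt.le⟩)).trans hη₀
  exact ⟨ζ, ⟨contDiff_infty_iff_deriv.2 ⟨fun t => (hderiv t).differentiableAt, hζ_deriv ▸ hη.1⟩,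
    isCompact_Icc.of_isClosed_subset (isClosed_tsupport _) hsupp,
    hsupp.trans (Icc_subset_Ioo hac (hη.2.2 hd.1).2)⟩, hζ_deriv⟩

lemma exists_isTest_integral_eq_one (hab : a < b) :
    ∃ η : ℝ → ℝ, IsTest (Ioo a b) η ∧ ∫ t, η t = 1 := by
  let f : ContDiffBump ((a + b) / 2) :=
    ⟨(b - a) / 8, (b - a) / 4, by linarith, by linarith⟩
  refine ⟨f.normed volume, ⟨f.contDiff_normed, f.hasCompactSupport_normed, ?_⟩, f.integral_normed⟩
  rw [f.tsupport_normed_eq, Real.closedBall_eq_Icc]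
  exact Icc_subset_Ioo (by simp only [f]; linarith) (by simp only [f]; linarith)

/-- `g` is the weak derivative of `f` on the interval `(a,b)`, for functions with values in a normed
space. -/
def HasWeakDerivOn (f g : ℝ → X) (a b : ℝ) : Prop :=
  ∀ η : ℝ → ℝ, IsTest (Ioo a b) η →
    ∫ t in Ioo a b, deriv η t • f t = -∫ t in Ioo a b, η t • g t

lemma hasWeakDerivOn_primitive [CompleteSpace X] (hab : a ≤ b) {g : ℝ → X}
    (hg : IntegrableOn g (Ioo a b)) : HasWeakDerivOn (fun t => ∫ s in a..t, g s) g a b := by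
  intro η hη
  have hg' : IntervalIntegrable g volume a b :=
    (intervalIntegrable_iff_integrableOn_Ioo_of_le hab).2 hg
  have hprim := absolutelyContinuousOnInterval_primitive hg'
  have hηac : AbsolutelyContinuousOnInterval η a b :=
    (hη.1.of_le (by simp)).contDiffOn.absolutelyContinuousOnInterval
  have hint₁ : IntervalIntegrable (fun t => deriv η t • ∫ s in a..t, g s) volume a b :=
    (hη.deriv.1.continuous.continuousOn.smul hprim.continuousOn).intervalIntegrable
  have hint₂ : IntervalIntegrable (fun t => η t • g t) volume a b :=
    hg'.continuousOn_smul hη.1.continuous.continuousOn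
  have hFTC := integral_eq_sub_of_ae_hasDerivAt (hηac.smul hprim)
    (f' := fun t => η t • g t + deriv η t • ∫ s in a..t, g s) (by
      filter_upwards [hg'.ae_hasDerivAt_integral] with t h ht
      exact (hη.1.differentiable (by simp) t).hasDerivAt.smul (h ht a left_mem_uIcc))
    (hint₂.add hint₁)
  rw [intervalIntegral.integral_add hint₂ hint₁] at hFTC
  simp only [Pi.smul_apply', hη.eq_zero_of_notMem right_notMem_Ioo,
    hη.eq_zero_of_notMem left_notMem_Ioo, zero_smul, sub_zero] at hFTC
  simpa only [intervalIntegral.integral_of_le hab, integral_Ioc_eq_integral_Ioo] using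
    eq_neg_of_add_eq_zero_right hFTC

lemma setIntegral_smul_eq_of_hasWeakDerivOn_zero {f : ℝ → X} (hf : IntegrableOn f (Ioo a b))
    (h : HasWeakDerivOn f 0 a b) {η η₀ : ℝ → ℝ} (hη : IsTest (Ioo a b) η)
    (hη₀ : IsTest (Ioo a b) η₀) (hη₀_one : ∫ t, η₀ t = 1) :
    ∫ t in Ioo a b, η t • f t = (∫ t, η t) • ∫ t in Ioo a b, η₀ t • f t := by
  have hη_int : Integrable η := hη.1.continuous.integrable_of_hasCompactSupport hη.2.1
  have hη₀_int : Integrable η₀ := hη₀.1.continuous.integrable_of_hasCompactSupport hη₀.2.1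
  obtain ⟨ζ, hζ, hζ_deriv⟩ := exists_isTest_deriv_eq (hη.add (hη₀.smul (-∫ t, η t))) (by
    simp only [Pi.add_apply, Pi.smul_apply, smul_eq_mul]
    rw [integral_add hη_int (hη₀_int.const_mul _), integral_const_mul, hη₀_one, mul_one,
      add_neg_cancel])
  have hη₀f : IntegrableOn (fun t => (-∫ t, η t) • η₀ t • f t) (Ioo a b) :=
    (hη₀.integrable_smul hf).smul _
  have hweak := h ζ hζ
  simp only [hζ_deriv, Pi.add_apply, Pi.smul_apply, Pi.zero_apply, smul_eq_mul, add_smul,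
    mul_smul, smul_zero, integral_zero, neg_zero] at hweak
  rwa [integral_add (hη.integrable_smul hf) hη₀f, integral_smul, neg_smul, ← sub_eq_add_neg,
    sub_eq_zero] at hweak

lemma ae_eq_const_of_hasWeakDerivOn_zero [CompleteSpace X] (hab : a < b) {f : ℝ → X}
    (hf : IntegrableOn f (Ioo a b)) (h : HasWeakDerivOn f 0 a b) :
    ∃ c, ∀ᵐ t ∂volume.restrict (Ioo a b), f t = c := by
  obtain ⟨η₀, hη₀, hη₀_one⟩ := exists_isTest_integral_eq_one hab
  set c : X := ∫ t in Ioo a b, η₀ t • f t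
  have hconst : IntegrableOn (fun _ => c) (Ioo a b) := integrable_const c
  have hae := ae_eq_zero_of_forall_isTest isOpen_Ioo (hf.sub hconst) fun η hη => by
    simp only [Pi.sub_apply, smul_sub]
    rw [integral_sub (hη.integrable_smul hf) (hη.integrable_smul hconst),
      hη.setIntegral_smul fun _ => c, integral_smul_const, sub_eq_zero]
    exact setIntegral_smul_eq_of_hasWeakDerivOn_zero hf h hη hη₀ hη₀_one
  exact ⟨c, hae.mono fun t ht => sub_eq_zero.1 ht⟩

lemma HasWeakDerivOn.exists_ae_eq_add_integral [CompleteSpace X] (hab : a < b) {f g : ℝ → X}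
    (hf : IntegrableOn f (Ioo a b)) (hg : IntegrableOn g (Ioo a b)) (h : HasWeakDerivOn f g a b) :
    ∃ c, ∀ᵐ t ∂volume.restrict (Ioo a b), f t = c + ∫ s in a..t, g s := by
  have hprim : IntegrableOn (fun t => ∫ s in a..t, g s) (Ioo a b) := by
    have hcont := (absolutelyContinuousOnInterval_primitive
      ((intervalIntegrable_iff_integrableOn_Ioo_of_le hab.le).2 hg)).continuousOn
    rw [uIcc_of_le hab.le] at hcont
    exact (hcont.integrableOn_compact isCompact_Icc).mono_set Ioo_subset_Icc_self
  obtain ⟨c, hc⟩ := ae_eq_const_of_hasWeakDerivOn_zero hab (hf.sub hprim) fun η hη => by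
    simp only [Pi.sub_apply, Pi.zero_apply, smul_sub, smul_zero, integral_zero, neg_zero]
    rw [integral_sub (hη.deriv.integrable_smul hf) (hη.deriv.integrable_smul hprim), h η hη,
      hasWeakDerivOn_primitive hab.le hg η hη, sub_self]
  exact ⟨c, hc.mono fun t ht => sub_eq_iff_eq_add.1 ht⟩

lemma HasWeakDerivOn.clm_comp [CompleteSpace X] {Y : Type*} [NormedAddCommGroup Y]
    [NormedSpace ℝ Y] [CompleteSpace Y] (L : X →L[ℝ] Y) {f g : ℝ → X}
    (hf : IntegrableOn f (Ioo a b)) (hg : IntegrableOn g (Ioo a b)) (h : HasWeakDerivOn f g a b) :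
    HasWeakDerivOn (fun t => L (f t)) (fun t => L (g t)) a b := by
  intro η hη
  simp only [← map_smul]
  rw [L.integral_comp_comm (hη.deriv.integrable_smul hf),
    L.integral_comp_comm (hη.integrable_smul hg), h η hη, map_neg]

lemma HasWeakDerivOn.ae_eq_zero [CompleteSpace X] {g : ℝ → X} (hg : IntegrableOn g (Ioo a b))
    (h : HasWeakDerivOn 0 g a b) : ∀ᵐ t ∂volume.restrict (Ioo a b), g t = 0 :=
  ae_eq_zero_of_forall_isTest isOpen_Ioo hg fun η hη => by
    simpa only [Pi.zero_apply, smul_zero, integral_zero, zero_eq_neg] using h η hη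

end WeakDerivative

section Landweber

variable {X H : Type*} [NormedAddCommGroup X] [InnerProductSpace ℝ X]
  [NormedAddCommGroup H] [InnerProductSpace ℝ H] (ι : X →L[ℝ] H)

/-- The relaxation parameter of the Landweber iteration. -/
def relaxation : ℝ := (1 + ‖ι‖ ^ 2)⁻¹

lemma relaxation_pos : 0 < relaxation ι := by
  unfold relaxation; positivity

variable [CompleteSpace X] [CompleteSpace H]

/-- The error propagation operator `1 - ω ι†ι` of the Landweber iteration, i.e. of gradient descent
for `x ↦ ‖ι x - y‖²`; its powers tend to zero strongly on the orthogonal complement of `ker ι`. -/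
def landweber : X →L[ℝ] X := 1 - relaxation ι • (ι.adjoint ∘L ι)

/-- The operator `ω ∑_{k < n} (1 - ω ι†ι)ᵏ`, an approximate inverse of `ι†ι`: the `n`-th Landweber
iterate for `ι x = y` is its value at `ι† y`. -/
def landweberInv (n : ℕ) : X →L[ℝ] X := relaxation ι • ∑ k ∈ Finset.range n, landweber ι ^ k

lemma isSelfAdjoint_landweber_pow (n : ℕ) : IsSelfAdjoint (landweber ι ^ n) :=
  ((IsSelfAdjoint.one _).sub ((IsSelfAdjoint.all (relaxation ι)).smul
    (ContinuousLinearMap.isSelfAdjoint_iff'.2 (by simp)))).pow n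

lemma commute_landweber_pow (n : ℕ) : Commute (ι.adjoint ∘L ι) (landweber ι ^ n) :=
  ((Commute.one_right _).sub_right ((Commute.refl _).smul_right _)).pow_right n

lemma landweberInv_comp_adjoint_comp_self (n : ℕ) :
    landweberInv ι n ∘L (ι.adjoint ∘L ι) = 1 - landweber ι ^ n := by
  rw [← geom_sum_mul_neg, landweber, sub_sub_cancel, landweberInv, landweber,
    ContinuousLinearMap.smul_comp, mul_smul_comm]
  rfl

lemma adjoint_comp_self_comp_landweberInv (n : ℕ) :
    (ι.adjoint ∘L ι) ∘L landweberInv ι n = 1 - landweber ι ^ n := by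
  rw [← mul_neg_geom_sum, landweber, sub_sub_cancel, landweberInv, landweber,
    ContinuousLinearMap.comp_smul, smul_mul_assoc]
  rfl

lemma norm_sq_landweber_add_le (x : X) :
    ‖landweber ι x‖ ^ 2 + relaxation ι * ‖ι x‖ ^ 2 ≤ ‖x‖ ^ 2 := by
  have hω := relaxation_pos ι
  have hJ : ‖ι.adjoint (ι x)‖ ^ 2 ≤ ‖ι‖ ^ 2 * ‖ι x‖ ^ 2 := by
    rw [← mul_pow]
    gcongr
    simpa only [LinearIsometryEquiv.norm_map] using ι.adjoint.le_opNorm (ι x)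
  have hω_mul : relaxation ι * ‖ι‖ ^ 2 ≤ 1 := by
    rw [relaxation, inv_mul_le_one₀ (by positivity)]
    linarith
  have hexpand : ‖landweber ι x‖ ^ 2 = ‖x‖ ^ 2 - 2 * (relaxation ι * ‖ι x‖ ^ 2)
      + relaxation ι ^ 2 * ‖ι.adjoint (ι x)‖ ^ 2 := by
    change ‖x - relaxation ι • ι.adjoint (ι x)‖ ^ 2 = _
    rw [norm_sub_sq_real, real_inner_smul_right, ContinuousLinearMap.adjoint_inner_right,
      real_inner_self_eq_norm_sq, norm_smul, mul_pow, Real.norm_eq_abs, sq_abs]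
  have hquad : relaxation ι ^ 2 * ‖ι.adjoint (ι x)‖ ^ 2 ≤ relaxation ι * ‖ι x‖ ^ 2 := calc
    _ ≤ relaxation ι ^ 2 * (‖ι‖ ^ 2 * ‖ι x‖ ^ 2) := by gcongr
    _ = relaxation ι * ‖ι‖ ^ 2 * (relaxation ι * ‖ι x‖ ^ 2) := by ring
    _ ≤ 1 * (relaxation ι * ‖ι x‖ ^ 2) := by gcongr
    _ = relaxation ι * ‖ι x‖ ^ 2 := one_mul _
  linarith

lemma norm_sq_landweber_pow_add_sum_le (x : X) (n : ℕ) :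
    ‖(landweber ι ^ n) x‖ ^ 2
      + relaxation ι * ∑ k ∈ Finset.range n, ‖ι ((landweber ι ^ k) x)‖ ^ 2 ≤ ‖x‖ ^ 2 := by
  induction n with
  | zero => simp
  | succ n ih =>
    have hstep := norm_sq_landweber_add_le ι ((landweber ι ^ n) x)
    rw [Finset.sum_range_succ, pow_succ' (landweber ι), mul_apply_eq_comp]
    linarith

lemma norm_landweber_pow_le (x : X) (n : ℕ) : ‖(landweber ι ^ n) x‖ ≤ ‖x‖ := by
  have hsum : 0 ≤ relaxation ι * ∑ k ∈ Finset.range n, ‖ι ((landweber ι ^ k) x)‖ ^ 2 :=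
    mul_nonneg (relaxation_pos ι).le (Finset.sum_nonneg fun _ _ => sq_nonneg _)
  exact le_of_sq_le_sq (by linarith [norm_sq_landweber_pow_add_sum_le ι x n]) (norm_nonneg x)

lemma tendsto_apply_landweber_pow (x : X) :
    Tendsto (fun n => ι ((landweber ι ^ n) x)) atTop (𝓝 0) := by
  have hsummable : Summable fun n => ‖ι ((landweber ι ^ n) x)‖ ^ 2 :=
    summable_of_sum_range_le (c := ‖x‖ ^ 2 / relaxation ι) (fun _ => sq_nonneg _) fun n => by
      rw [le_div_iff₀' (relaxation_pos ι)]
      linarith [norm_sq_landweber_pow_add_sum_le ι x n, sq_nonneg ‖(landweber ι ^ n) x‖]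
  rw [tendsto_zero_iff_norm_tendsto_zero]
  simpa using hsummable.tendsto_atTop_zero.sqrt

lemma tendsto_landweber_pow {x : X} (hx : x ∈ (ι.ker)ᗮ) :
    Tendsto (fun n => (landweber ι ^ n) x) atTop (𝓝 0) := by
  have hequi : Equicontinuous fun n => ⇑(landweber ι ^ n) :=
    (LipschitzWith.uniformEquicontinuous _ 1 fun n =>
      AddMonoidHomClass.lipschitz_of_bound_nnnorm (landweber ι ^ n) 1 fun x => by
        rw [one_mul]; exact norm_landweber_pow_le ι x n).equicontinuous
  have hrange : ((ι.adjoint ∘L ι).range : Set X)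
      ⊆ {x | Tendsto (fun n => (landweber ι ^ n) x) atTop (𝓝 0)} := by
    rintro _ ⟨y, rfl⟩
    have hcomm : ∀ n, (landweber ι ^ n) (ι.adjoint (ι y)) = ι.adjoint (ι ((landweber ι ^ n) y)) :=
      fun n => (DFunLike.congr_fun (commute_landweber_pow ι n) y).symm
    have hlim := (ι.adjoint.continuous.tendsto 0).comp (tendsto_apply_landweber_pow ι y)
    rw [map_zero] at hlim
    exact hlim.congr fun n => (hcomm n).symm
  have hJ_adjoint : (ι.adjoint ∘L ι).adjoint = ι.adjoint ∘L ι := by simp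
  rw [← ι.ker_adjoint_comp_self, ContinuousLinearMap.orthogonal_ker, hJ_adjoint] at hx
  exact closure_minimal hrange (hequi.isClosed_setOfPred_tendsto continuous_const) hx

end Landweber

section GelfandDerivative

variable {X H : Type*} [NormedAddCommGroup X] [InnerProductSpace ℝ X] [NormedAddCommGroup H]
  [InnerProductSpace ℝ H] {ι : X →L[ℝ] H} {a b : ℝ} {u : ℝ → X} {u' : ℝ → (X →L[ℝ] ℝ)}

/-- `u'` is the weak derivative of `u` on `(a,b)` as a function with values in the dual of `X`,
where `x` is identified with the functional `(ι x, ι ·)`, as in a Gelfand triple. Here `ι` need be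
neither injective nor of dense range. -/
def HasGelfandDerivOn (ι : X →L[ℝ] H) (u : ℝ → X) (u' : ℝ → (X →L[ℝ] ℝ)) (a b : ℝ) : Prop :=
  ∀ (ψ : X) (η : ℝ → ℝ), IsTest (Ioo a b) η →
    ∫ t in Ioo a b, inner ℝ (ι (u t)) (ι ψ) * deriv η t = -∫ t in Ioo a b, u' t ψ * η t

variable [CompleteSpace X]

/-- The Riesz representative of a functional-valued function. -/
def riesz (u' : ℝ → (X →L[ℝ] ℝ)) (t : ℝ) : X := (InnerProductSpace.toDual ℝ X).symm (u' t)

lemma inner_riesz (u' : ℝ → (X →L[ℝ] ℝ)) (t : ℝ) (x : X) : inner ℝ (riesz u' t) x = u' t x :=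
  InnerProductSpace.toDual_symm_apply

lemma memLp_riesz {p : ℝ≥0∞} {μ : Measure ℝ} (hu' : MemLp u' p μ) : MemLp (riesz u') p μ :=
  (InnerProductSpace.toDual ℝ X).symm.toContinuousLinearEquiv.toContinuousLinearMap.comp_memLp' hu'

variable [CompleteSpace H]

lemma HasGelfandDerivOn.hasWeakDerivOn (hu : IntegrableOn u (Ioo a b))
    (hg : IntegrableOn (riesz u') (Ioo a b)) (h : HasGelfandDerivOn ι u u' a b) :
    HasWeakDerivOn (fun t => (ι.adjoint ∘L ι) (u t)) (riesz u') a b := by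
  intro η hη
  refine ext_inner_right ℝ fun ψ => ?_
  rw [inner_neg_left, real_inner_comm, real_inner_comm ψ,
    ← integral_inner (hη.deriv.integrable_smul ((ι.adjoint ∘L ι).integrable_comp hu)),
    ← integral_inner (hη.integrable_smul hg)]
  simpa only [real_inner_comm _ ψ, real_inner_smul_left, inner_riesz, mul_comm,
    ContinuousLinearMap.comp_apply, ContinuousLinearMap.adjoint_inner_left] using h ψ η hη

lemma HasGelfandDerivOn.ae_mem_orthogonal_ker (hu : IntegrableOn u (Ioo a b))
    (hg : IntegrableOn (riesz u') (Ioo a b)) (h : HasGelfandDerivOn ι u u' a b) :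
    ∀ᵐ t ∂volume.restrict (Ioo a b), riesz u' t ∈ (ι.ker)ᗮ := by
  have : CompleteSpace ι.ker := ι.isClosed_ker.completeSpace_coe
  have hproj : ∀ x, ι.ker.starProjection ((ι.adjoint ∘L ι) x) = 0 := fun x => by
    rw [Submodule.starProjection_apply_eq_zero_iff]
    exact fun y hy => by
      rw [ContinuousLinearMap.comp_apply, ContinuousLinearMap.adjoint_inner_right,
        show ι y = 0 from hy, inner_zero_left]
  have hzero := (h.hasWeakDerivOn hu hg).clm_comp ι.ker.starProjection
    ((ι.adjoint ∘L ι).integrable_comp hu) hg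
  simp only [hproj] at hzero
  filter_upwards [hzero.ae_eq_zero (ι.ker.starProjection.integrable_comp hg)] with t ht
  exact (Submodule.starProjection_apply_eq_zero_iff _).1 ht

end GelfandDerivative

section IntervalIntegral

variable {a b s t : ℝ}

lemma ae_restrict_uIoc_of_ae_restrict_Ioo (hs : s ∈ Icc a b) (ht : t ∈ Icc a b) {p : ℝ → Prop}
    (h : ∀ᵐ r ∂volume.restrict (Ioo a b), p r) : ∀ᵐ r ∂volume.restrict (uIoc s t), p r := by
  rw [Measure.restrict_congr_set Ioo_ae_eq_Icc] at h
  exact ae_restrict_of_ae_restrict_of_subset (uIoc_subset_uIcc.trans (uIcc_subset_Icc hs ht)) h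

lemma intervalIntegrable_of_integrableOn_Ioo {Y : Type*} [NormedAddCommGroup Y] {f : ℝ → Y}
    (hf : IntegrableOn f (Ioo a b)) (hs : s ∈ Icc a b) (ht : t ∈ Icc a b) :
    IntervalIntegrable f volume s t := by
  rw [integrableOn_congr_set_ae Ioo_ae_eq_Icc] at hf
  exact (hf.mono_set (uIcc_subset_Icc hs ht)).intervalIntegrable

lemma norm_intervalIntegral_le_setIntegral_Ioo {Y : Type*} [NormedAddCommGroup Y] [NormedSpace ℝ Y]
    {f : ℝ → Y} {k : ℝ → ℝ} (hs : s ∈ Icc a b) (ht : t ∈ Icc a b) (hk : IntegrableOn k (Ioo a b))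
    (hfk : ∀ r, ‖f r‖ ≤ k r) : ‖∫ r in s..t, f r‖ ≤ ∫ r in Ioo a b, k r := by
  have hsub : uIoc s t ⊆ Icc a b := uIoc_subset_uIcc.trans (uIcc_subset_Icc hs ht)
  rw [integrableOn_congr_set_ae Ioo_ae_eq_Icc] at hk
  rw [setIntegral_congr_set Ioo_ae_eq_Icc, intervalIntegral.norm_intervalIntegral_eq]
  exact (norm_integral_le_of_norm_le (hk.mono_set hsub) (Eventually.of_forall hfk)).trans
    (setIntegral_mono_set hk (Eventually.of_forall fun r => (norm_nonneg _).trans (hfk r))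
      hsub.eventuallyLE)

end IntervalIntegral

lemma uniformCauchySeqOn_of_norm_sq_sub_le {S H : Type*} [SeminormedAddCommGroup H]
    {v : ℕ → S → H} {A : Set S} {s : S} {δ : ℕ → ℝ} (hs : CauchySeq fun n => v n s)
    (hδ : Tendsto δ atTop (𝓝 0))
    (h : ∀ n m, ∀ t ∈ A, ‖v n t - v m t‖ ^ 2 ≤ ‖v n s - v m s‖ ^ 2 + (δ n + δ m)) :
    UniformCauchySeqOn v atTop A := by
  rw [Metric.uniformCauchySeqOn_iff]
  intro ε hε
  obtain ⟨N₁, hN₁⟩ := Metric.cauchySeq_iff.1 hs (ε / 2) (half_pos hε)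
  obtain ⟨N₂, hN₂⟩ := (hδ.eventually
    (gt_mem_nhds (show 0 < ε ^ 2 / 4 by positivity))).exists_forall_of_atTop
  refine ⟨max N₁ N₂, fun n hn m hm t ht => ?_⟩
  have hs_lt := hN₁ n (le_of_max_le_left hn) m (le_of_max_le_left hm)
  have hn_lt := hN₂ n (le_of_max_le_right hn)
  have hm_lt := hN₂ m (le_of_max_le_right hm)
  rw [dist_eq_norm] at hs_lt ⊢
  have hs_sq : ‖v n s - v m s‖ ^ 2 ≤ (ε / 2) ^ 2 := by gcongr
  refine lt_of_pow_lt_pow_left₀ 2 hε.le ?_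
  linarith [h n m t ht, sq_nonneg ε]

section LandweberInner

variable {X H : Type*} [NormedAddCommGroup X] [InnerProductSpace ℝ X] [CompleteSpace X]
  [NormedAddCommGroup H] [InnerProductSpace ℝ H] [CompleteSpace H] (ι : X →L[ℝ] H)

lemma inner_landweber_pow_left (n : ℕ) (x y : X) :
    inner ℝ ((landweber ι ^ n) x) y = inner ℝ x ((landweber ι ^ n) y) := by
  rw [← ContinuousLinearMap.adjoint_inner_right, (isSelfAdjoint_landweber_pow ι n).adjoint_eq]

lemma norm_inner_landweber_pow_le (n m : ℕ) (x y : X) :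
    ‖inner ℝ ((landweber ι ^ m) x) ((landweber ι ^ n) y)‖ ≤ ‖x‖ * ‖(landweber ι ^ n) y‖ :=
  (norm_inner_le_norm _ _).trans (by gcongr; exact norm_landweber_pow_le ι x m)

lemma norm_inner_landweber_pow_sub_le (n m : ℕ) (x y : X) :
    ‖inner ℝ ((landweber ι ^ n - landweber ι ^ m) x) ((landweber ι ^ n - landweber ι ^ m) y)‖
      ≤ 2 * (‖x‖ * ‖(landweber ι ^ n) y‖) + 2 * (‖x‖ * ‖(landweber ι ^ m) y‖) := by
  have h₁ := norm_inner_landweber_pow_le ι n n x y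
  have h₂ := norm_inner_landweber_pow_le ι n m x y
  have h₃ := norm_inner_landweber_pow_le ι m n x y
  have h₄ := norm_inner_landweber_pow_le ι m m x y
  simp only [sub_apply, inner_sub_left, inner_sub_right]
  rw [Real.norm_eq_abs, abs_le] at *
  constructor <;> linarith

lemma norm_inner_one_sub_landweber_pow_sub_le (n : ℕ) (x y : X) :
    ‖inner ℝ ((1 - landweber ι ^ n) x) ((1 - landweber ι ^ n) y) - inner ℝ x y‖
      ≤ 3 * (‖x‖ * ‖(landweber ι ^ n) y‖) := by
  have h₁ := norm_inner_landweber_pow_le ι n n x y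
  have h₂ := norm_inner_landweber_pow_le ι n 0 x y
  simp only [pow_zero, sub_apply, one_apply_eq_self, inner_sub_left,
    inner_sub_right, inner_landweber_pow_left ι n x y] at h₁ h₂ ⊢
  rw [Real.norm_eq_abs, abs_le] at *
  constructor <;> linarith

end LandweberInner

section LionsMagenes

variable {X H : Type*} [NormedAddCommGroup X] [InnerProductSpace ℝ X] [CompleteSpace X]
  [NormedAddCommGroup H] [InnerProductSpace ℝ H] [CompleteSpace H] {ι : X →L[ℝ] H} {a b : ℝ}
  {u g : ℝ → X} {c : X}

lemma norm_sq_apply_primitive (hg : IntegrableOn g (Ioo a b))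
    (hprim : ∀ᵐ t ∂volume.restrict (Ioo a b), (ι.adjoint ∘L ι) (u t) = c + ∫ s in a..t, g s)
    {D : X →L[ℝ] X} (hD : Commute (ι.adjoint ∘L ι) D) {s t : ℝ} (hs : s ∈ Icc a b)
    (ht : t ∈ Icc a b) :
    ‖ι (D (c + ∫ r in a..t, g r))‖ ^ 2 = ‖ι (D (c + ∫ r in a..s, g r))‖ ^ 2
      + 2 * ∫ r in s..t, inner ℝ ((D ∘L ι.adjoint ∘L ι) (u r)) ((D ∘L ι.adjoint ∘L ι) (g r)) := by
  have ha : a ∈ Icc a b := left_mem_Icc.2 (hs.1.trans hs.2)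
  have hprim_add : ∀ r ∈ Icc a b, ι (D (c + ∫ x in a..r, g x))
      = ι (D (c + ∫ x in a..s, g x)) + ∫ x in s..r, ι (D (g x)) := fun r hr => by
    rw [← intervalIntegral.integral_add_adjacent_intervals
      (intervalIntegrable_of_integrableOn_Ioo hg ha hs)
      (intervalIntegrable_of_integrableOn_Ioo hg hs hr), ← add_assoc, map_add, map_add]
    exact congrArg _ ((ι ∘L D).intervalIntegral_comp_comm
      (intervalIntegrable_of_integrableOn_Ioo hg hs hr)).symm
  have hgst : IntervalIntegrable (fun r => ι (D (g r))) volume s t :=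
    intervalIntegrable_of_integrableOn_Ioo ((ι ∘L D).integrable_comp hg) hs ht
  rw [hprim_add t ht, norm_sq_add_integral hgst]
  congr 2
  refine intervalIntegral.integral_congr_ae_restrict ?_
  filter_upwards [ae_restrict_uIoc_of_ae_restrict_Ioo hs ht hprim,
    ae_restrict_mem measurableSet_uIoc] with r hr hrst
  have hDg : ι.adjoint (ι (D (g r))) = D (ι.adjoint (ι (g r))) := DFunLike.congr_fun hD (g r)
  have hr_mem : r ∈ Icc a b := uIcc_subset_Icc hs ht (uIoc_subset_uIcc hrst)
  rw [← hprim_add r hr_mem, ← hr, ← ContinuousLinearMap.adjoint_inner_right, hDg]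
  rfl

/-- The values `ι (S c + ∫_a^t S g)`, where `S` is the `n`-th approximate inverse of `ι†ι`. They
approximate `ι x` wherever the primitive `c + ∫_a^t g` has the value `ι†ι x`. -/
def landweberApprox (ι : X →L[ℝ] H) (a : ℝ) (c : X) (g : ℝ → X) (n : ℕ) (t : ℝ) : H :=
  ι (landweberInv ι n (c + ∫ s in a..t, g s))

lemma continuousOn_landweberApprox (hg : IntegrableOn g (Ioo a b)) (n : ℕ) :
    ContinuousOn (landweberApprox ι a c g n) (Icc a b) := by
  rcases lt_or_ge b a with hba | hab
  · simp [Icc_eq_empty_of_lt hba]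
  have hprim := intervalIntegral.continuousOn_primitive_interval'
    ((intervalIntegrable_iff_integrableOn_Ioo_of_le hab).2 hg) left_mem_uIcc
  rw [uIcc_of_le hab] at hprim
  exact (ι ∘L landweberInv ι n).continuous.comp_continuousOn (continuousOn_const.add hprim)

lemma tendsto_landweberApprox {x : X} {t : ℝ} (h : (ι.adjoint ∘L ι) x = c + ∫ s in a..t, g s) :
    Tendsto (fun n => landweberApprox ι a c g n t) atTop (𝓝 (ι x)) := by
  have happrox : ∀ n, landweberApprox ι a c g n t = ι x - ι ((landweber ι ^ n) x) := fun n => by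
    have hinv : landweberInv ι n ((ι.adjoint ∘L ι) x) = x - (landweber ι ^ n) x :=
      DFunLike.congr_fun (landweberInv_comp_adjoint_comp_self ι n) x
    rw [landweberApprox, ← h, hinv, map_sub]
  simp only [happrox]
  simpa only [sub_zero] using (tendsto_apply_landweber_pow ι x).const_sub (ι x)

lemma commute_landweberInv (ι : X →L[ℝ] H) (n : ℕ) :
    Commute (ι.adjoint ∘L ι) (landweberInv ι n) :=
  (adjoint_comp_self_comp_landweberInv ι n).trans (landweberInv_comp_adjoint_comp_self ι n).symm

lemma norm_sq_landweberApprox (hg : IntegrableOn g (Ioo a b))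
    (hprim : ∀ᵐ t ∂volume.restrict (Ioo a b), (ι.adjoint ∘L ι) (u t) = c + ∫ s in a..t, g s)
    (n : ℕ) {t : ℝ} (ht : t ∈ Icc a b) :
    ‖landweberApprox ι a c g n t‖ ^ 2 = ‖landweberApprox ι a c g n a‖ ^ 2
      + 2 * ∫ r in a..t, inner ℝ ((1 - landweber ι ^ n) (u r)) ((1 - landweber ι ^ n) (g r)) := by
  rw [← landweberInv_comp_adjoint_comp_self]
  exact norm_sq_apply_primitive hg hprim (commute_landweberInv ι n)
    (left_mem_Icc.2 (ht.1.trans ht.2)) ht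

lemma integrableOn_norm_mul_norm_landweber_pow (hu : MemLp u 2 (volume.restrict (Ioo a b)))
    (hg : MemLp g 2 (volume.restrict (Ioo a b))) (n : ℕ) :
    IntegrableOn (fun t => ‖u t‖ * ‖(landweber ι ^ n) (g t)‖) (Ioo a b) :=
  hu.norm.integrable_mul ((landweber ι ^ n).comp_memLp' hg).norm

lemma norm_sq_landweberApprox_sub_le (hu : MemLp u 2 (volume.restrict (Ioo a b)))
    (hg : MemLp g 2 (volume.restrict (Ioo a b)))
    (hprim : ∀ᵐ t ∂volume.restrict (Ioo a b), (ι.adjoint ∘L ι) (u t) = c + ∫ s in a..t, g s)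
    (n m : ℕ) {s t : ℝ} (hs : s ∈ Icc a b) (ht : t ∈ Icc a b) :
    ‖landweberApprox ι a c g n t - landweberApprox ι a c g m t‖ ^ 2
      ≤ ‖landweberApprox ι a c g n s - landweberApprox ι a c g m s‖ ^ 2
        + (4 * (∫ r in Ioo a b, ‖u r‖ * ‖(landweber ι ^ n) (g r)‖)
          + 4 * ∫ r in Ioo a b, ‖u r‖ * ‖(landweber ι ^ m) (g r)‖) := by
  have hD : (landweberInv ι m - landweberInv ι n) ∘L ι.adjoint ∘L ι
      = landweber ι ^ n - landweber ι ^ m := by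
    rw [ContinuousLinearMap.sub_comp, landweberInv_comp_adjoint_comp_self,
      landweberInv_comp_adjoint_comp_self, sub_sub_sub_cancel_left]
  have hid := norm_sq_apply_primitive (hg.integrable one_le_two) hprim
    ((commute_landweberInv ι m).sub_right (commute_landweberInv ι n)) hs ht
  have hn := (integrableOn_norm_mul_norm_landweber_pow (ι := ι) hu hg n).const_mul 2
  have hm := (integrableOn_norm_mul_norm_landweber_pow (ι := ι) hu hg m).const_mul 2
  have hint := (le_abs_self _).trans <| norm_intervalIntegral_le_setIntegral_Ioo hs ht
    (hn.add hm) fun r => norm_inner_landweber_pow_sub_le ι n m (u r) (g r)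
  simp only [Pi.add_apply] at hint
  rw [integral_add hn hm, integral_const_mul, integral_const_mul] at hint
  simp only [hD] at hid
  rw [norm_sub_rev, norm_sub_rev (landweberApprox ι a c g n s)]
  simp only [landweberApprox, ← map_sub, ← sub_apply]
  linarith

lemma tendsto_integral_norm_mul_norm_landweber_pow (hu : MemLp u 2 (volume.restrict (Ioo a b)))
    (hg : MemLp g 2 (volume.restrict (Ioo a b)))
    (hg_orth : ∀ᵐ t ∂volume.restrict (Ioo a b), g t ∈ (ι.ker)ᗮ) :
    Tendsto (fun n => ∫ t in Ioo a b, ‖u t‖ * ‖(landweber ι ^ n) (g t)‖) atTop (𝓝 0) := by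
  have hlim := tendsto_integral_of_dominated_convergence (fun t => ‖u t‖ * ‖g t‖)
    (fun n => (integrableOn_norm_mul_norm_landweber_pow (ι := ι) hu hg n).aestronglyMeasurable)
    (hu.norm.integrable_mul hg.norm)
    (fun n => Eventually.of_forall fun t => by
      rw [norm_mul, norm_norm, norm_norm]
      gcongr
      exact norm_landweber_pow_le ι (g t) n)
    (hg_orth.mono fun t ht => (tendsto_landweber_pow ι ht).norm.const_mul ‖u t‖)
  simpa only [norm_zero, mul_zero, integral_zero] using hlim

lemma tendsto_integral_inner_one_sub_landweber_pow (hu : MemLp u 2 (volume.restrict (Ioo a b)))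
    (hg : MemLp g 2 (volume.restrict (Ioo a b)))
    (hg_orth : ∀ᵐ t ∂volume.restrict (Ioo a b), g t ∈ (ι.ker)ᗮ) {t : ℝ} (ht : t ∈ Icc a b) :
    Tendsto (fun n => ∫ r in a..t, inner ℝ ((1 - landweber ι ^ n : X →L[ℝ] X) (u r))
      ((1 - landweber ι ^ n : X →L[ℝ] X) (g r))) atTop (𝓝 (∫ r in a..t, inner ℝ (u r) (g r))) := by
  have ha : a ∈ Icc a b := left_mem_Icc.2 (ht.1.trans ht.2)
  have hinner : ∀ {v w : ℝ → X}, MemLp v 2 (volume.restrict (Ioo a b)) →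
      MemLp w 2 (volume.restrict (Ioo a b)) →
      IntervalIntegrable (fun r => inner ℝ (v r) (w r)) volume a t := fun hv hw =>
    intervalIntegrable_of_integrableOn_Ioo
      (memLp_one_iff_integrable.1 ((innerSL ℝ).memLp_of_bilin 1 hv hw)) ha ht
  have hlim := (tendsto_integral_norm_mul_norm_landweber_pow (ι := ι) hu hg hg_orth).const_mul 3
  rw [mul_zero] at hlim
  rw [tendsto_iff_norm_sub_tendsto_zero]
  refine squeeze_zero (fun _ => norm_nonneg _) (fun n => ?_) hlim
  let D : X →L[ℝ] X := 1 - landweber ι ^ n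
  have hinner_D : IntervalIntegrable (fun r => inner ℝ (D (u r)) (D (g r))) volume a t :=
    hinner (D.comp_memLp' hu) (D.comp_memLp' hg)
  rw [← intervalIntegral.integral_sub hinner_D (hinner hu hg), ← integral_const_mul]
  exact norm_intervalIntegral_le_setIntegral_Ioo ha ht
    ((integrableOn_norm_mul_norm_landweber_pow hu hg n).const_mul 3)
    fun r => norm_inner_one_sub_landweber_pow_sub_le ι n (u r) (g r)

theorem HasGelfandDerivOn.exists_continuousOn_ae_eq (hab : a < b) {u' : ℝ → (X →L[ℝ] ℝ)}
    (hu : MemLp u 2 (volume.restrict (Ioo a b))) (hu' : MemLp u' 2 (volume.restrict (Ioo a b)))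
    (h : HasGelfandDerivOn ι u u' a b) :
    ∃ w : ℝ → H, ContinuousOn w (Icc a b) ∧ (∀ᵐ t ∂volume.restrict (Ioo a b), w t = ι (u t)) ∧
      ∀ t ∈ Icc a b, ‖w t‖ ^ 2 = ‖w a‖ ^ 2 + 2 * ∫ s in a..t, u' s (u s) := by
  have hg : MemLp (riesz u') 2 (volume.restrict (Ioo a b)) := memLp_riesz hu'
  have hu_int : IntegrableOn u (Ioo a b) := hu.integrable one_le_two
  have hg_int : IntegrableOn (riesz u') (Ioo a b) := hg.integrable one_le_two
  have hg_orth := h.ae_mem_orthogonal_ker hu_int hg_int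
  obtain ⟨c, hprim⟩ := (h.hasWeakDerivOn hu_int hg_int).exists_ae_eq_add_integral hab
    ((ι.adjoint ∘L ι).integrable_comp hu_int) hg_int
  set v := landweberApprox ι a c (riesz u')
  have : (ae (volume.restrict (Ioo a b))).NeBot := by
    rw [ae_restrict_neBot, Real.volume_Ioo]
    simpa using hab
  obtain ⟨s, hs, hs_prim⟩ := ((ae_restrict_mem measurableSet_Ioo).and hprim).exists
  have hδ := (tendsto_integral_norm_mul_norm_landweber_pow (ι := ι) hu hg hg_orth).const_mul 4
  rw [mul_zero] at hδ
  have hcauchy : UniformCauchySeqOn v atTop (Icc a b) :=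
    uniformCauchySeqOn_of_norm_sq_sub_le (tendsto_landweberApprox hs_prim).cauchySeq hδ
      fun n m t ht => norm_sq_landweberApprox_sub_le hu hg hprim n m (Ioo_subset_Icc_self hs) ht
  choose! w hw using fun t (ht : t ∈ Icc a b) =>
    cauchySeq_tendsto_of_complete (hcauchy.cauchySeq ht)
  refine ⟨w, (hcauchy.tendstoUniformlyOn_of_tendsto hw).continuousOn
    (Frequently.of_forall (continuousOn_landweberApprox hg_int)), ?_, fun t ht => ?_⟩
  · filter_upwards [hprim, ae_restrict_mem measurableSet_Ioo] with t ht ht_mem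
    exact tendsto_nhds_unique (hw t (Ioo_subset_Icc_self ht_mem)) (tendsto_landweberApprox ht)
  · have henergy := (tendsto_integral_inner_one_sub_landweber_pow hu hg hg_orth ht).const_mul 2
    simp only [real_inner_comm (riesz u' _), inner_riesz] at henergy
    refine tendsto_nhds_unique ((hw t ht).norm.pow 2)
      ((((hw a (left_mem_Icc.2 hab.le)).norm.pow 2).add henergy).congr fun n => ?_)
    rw [norm_sq_landweberApprox hg_int hprim n ht]

end LionsMagenes

section Gronwall

variable {a b : ℝ} {y r k f : ℝ → ℝ}

lemma integral_exp_neg_mul_eq_sub (hk : IntervalIntegrable k volume a b)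
    (hr : IntervalIntegrable r volume a b) (c : ℝ) :
    ∫ t in a..b, Real.exp (-∫ s in a..t, k s) * (r t - k t * (c + ∫ s in a..t, r s))
      = Real.exp (-∫ s in a..b, k s) * (c + ∫ s in a..b, r s) - c := by
  have hexp : AbsolutelyContinuousOnInterval (fun t => Real.exp (-∫ s in a..t, k s)) a b :=
    absolutelyContinuousOnInterval_comp_of_contDiff (φ := fun x : ℝ => Real.exp (-x))
      (Real.contDiff_exp.comp contDiff_neg) (absolutelyContinuousOnInterval_primitive hk)
  have hprim : AbsolutelyContinuousOnInterval (fun t => c + ∫ s in a..t, r s) a b :=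
    (contDiffOn_const (c := c)).absolutelyContinuousOnInterval.add
      (absolutelyContinuousOnInterval_primitive hr)
  have hftc := integral_eq_sub_of_ae_hasDerivAt (hexp.fun_mul hprim)
    (f' := fun t => Real.exp (-∫ s in a..t, k s) * (r t - k t * (c + ∫ s in a..t, r s))) (by
      filter_upwards [hk.ae_hasDerivAt_integral, hr.ae_hasDerivAt_integral] with t hkt hrt ht
      convert! (hkt ht a left_mem_uIcc).neg.exp.mul ((hrt ht a left_mem_uIcc).const_add c) using 1
      simp only [Pi.neg_apply]
      ring)
    ((hr.sub (hk.mul_continuousOn hprim.continuousOn)).continuousOn_mul hexp.continuousOn)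
  simpa using hftc

lemma gronwall_of_eq_add_integral (hab : a ≤ b) (hr : IntervalIntegrable r volume a b)
    (hk : IntervalIntegrable k volume a b) (hf : IntervalIntegrable f volume a b)
    (hy : ∀ t ∈ Icc a b, y t = y a + ∫ s in a..t, r s)
    (hle : ∀ᵐ t ∂volume.restrict (Ioo a b), r t ≤ k t * y t + f t) :
    y b ≤ Real.exp (∫ s in a..b, k s) * y a
      + ∫ t in a..b, Real.exp ((∫ s in a..b, k s) - ∫ s in a..t, k s) * f t := by
  have hexp : ContinuousOn (fun t => Real.exp (-∫ s in a..t, k s)) (uIcc a b) :=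
    (absolutelyContinuousOnInterval_primitive hk).continuousOn.neg.rexp
  have hprim : ContinuousOn (fun t => y a + ∫ s in a..t, r s) (uIcc a b) :=
    continuousOn_const.add (absolutelyContinuousOnInterval_primitive hr).continuousOn
  have hmono : ∫ t in a..b, Real.exp (-∫ s in a..t, k s) * (r t - k t * (y a + ∫ s in a..t, r s))
      ≤ ∫ t in a..b, Real.exp (-∫ s in a..t, k s) * f t := by
    refine intervalIntegral.integral_mono_ae_restrict hab
      ((hr.sub (hk.mul_continuousOn hprim)).continuousOn_mul hexp) (hf.continuousOn_mul hexp) ?_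
    rw [← Measure.restrict_congr_set Ioo_ae_eq_Icc]
    filter_upwards [hle, ae_restrict_mem measurableSet_Ioo] with t ht ht_mem
    rw [← hy t (Ioo_subset_Icc_self ht_mem)]
    gcongr
    linarith
  rw [integral_exp_neg_mul_eq_sub hk hr, ← hy b (right_mem_Icc.2 hab), Real.exp_neg] at hmono
  simp only [sub_eq_add_neg, Real.exp_add, mul_assoc]
  rw [intervalIntegral.integral_const_mul, ← mul_add]
  exact (inv_mul_le_iff₀ (Real.exp_pos _)).1 (by linarith)

end Gronwall

section InitialValue

variable {a b : ℝ}

lemma neBot_nhdsGT_inf_ae (a : ℝ) : (𝓝[>] a ⊓ ae volume).NeBot := by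
  refine Filter.inf_neBot_iff.2 fun s hs s' hs' => ?_
  obtain ⟨b, hb, hbs⟩ := mem_nhdsGT_iff_exists_Ioo_subset.1 hs
  have hb_pos : volume (Ioo a b) ≠ 0 := by simpa [Real.volume_Ioo] using hb
  rw [← measure_inter_conull hs'] at hb_pos
  exact (nonempty_of_measure_ne_zero hb_pos).mono (inter_subset_inter_left s' hbs)

lemma eq_of_continuousOn_of_tendsto_nhdsGT_inf_ae {Y : Type*} [TopologicalSpace Y] [T2Space Y]
    {v w : ℝ → Y} {y : Y} (hab : a < b) (hw : ContinuousOn w (Icc a b))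
    (hwv : ∀ᵐ t ∂volume.restrict (Ioo a b), w t = v t)
    (hv : Tendsto v (𝓝[>] a ⊓ ae volume) (𝓝 y)) : w a = y := by
  have := neBot_nhdsGT_inf_ae a
  have hmem : ∀ᶠ t in 𝓝[>] a ⊓ ae volume, t ∈ Ioo a b :=
    mem_inf_of_left (Ioo_mem_nhdsGT hab)
  have hlim : Tendsto w (𝓝[>] a ⊓ ae volume) (𝓝 (w a)) :=
    (hw a (left_mem_Icc.2 hab.le)).tendsto.mono_left
      (inf_le_left.trans (nhdsWithin_le_of_mem (Icc_mem_nhdsGT hab)))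
  refine tendsto_nhds_unique hlim (hv.congr' ?_)
  filter_upwards [hmem, ((ae_restrict_iff' measurableSet_Ioo).1 hwv).filter_mono inf_le_right]
    with t ht hwvt using (hwvt ht).symm

end InitialValue

theorem HasGelfandDerivOn.exists_continuousOn_gronwall {X H : Type*} [NormedAddCommGroup X]
    [InnerProductSpace ℝ X] [CompleteSpace X] [NormedAddCommGroup H] [InnerProductSpace ℝ H]
    [CompleteSpace H] {ι : X →L[ℝ] H} {a b : ℝ} {u : ℝ → X} {u' : ℝ → (X →L[ℝ] ℝ)} {x₀ : H}
    {k f : ℝ → ℝ} (hab : a < b) (hu : MemLp u 2 (volume.restrict (Ioo a b)))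
    (hu' : MemLp u' 2 (volume.restrict (Ioo a b))) (h : HasGelfandDerivOn ι u u' a b)
    (hx₀ : Tendsto (fun t => ι (u t)) (𝓝[>] a ⊓ ae volume) (𝓝 x₀))
    (hk : IntegrableOn k (Ioo a b)) (hf : IntegrableOn f (Ioo a b))
    (hle : ∀ᵐ t ∂volume.restrict (Ioo a b), 2 * u' t (u t) ≤ k t * ‖ι (u t)‖ ^ 2 + f t) :
    ∃ w : ℝ → H, ContinuousOn w (Icc a b) ∧ (∀ᵐ t ∂volume.restrict (Ioo a b), w t = ι (u t)) ∧
      w a = x₀ ∧ ∀ t ∈ Icc a b, ‖w t‖ ^ 2 ≤ Real.exp (∫ s in a..t, k s) * ‖x₀‖ ^ 2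
        + ∫ τ in a..t, Real.exp ((∫ s in a..t, k s) - ∫ s in a..τ, k s) * f τ := by
  obtain ⟨w, hw, hwu, hw_sq⟩ := h.exists_continuousOn_ae_eq hab hu hu'
  have hwa := eq_of_continuousOn_of_tendsto_nhdsGT_inf_ae hab hw hwu hx₀
  have hpair : IntegrableOn (fun t => 2 * u' t (u t)) (Ioo a b) :=
    (memLp_one_iff_integrable.1
      ((ContinuousLinearMap.id ℝ (X →L[ℝ] ℝ)).memLp_of_bilin 1 hu' hu)).const_mul 2
  have hle_w : ∀ᵐ t ∂volume.restrict (Ioo a b), 2 * u' t (u t) ≤ k t * ‖w t‖ ^ 2 + f t := by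
    filter_upwards [hwu, hle] with t ht hle_t using ht ▸ hle_t
  refine ⟨w, hw, hwu, hwa, fun t ht => ?_⟩
  have hint : ∀ {g : ℝ → ℝ}, IntegrableOn g (Ioo a b) → IntervalIntegrable g volume a t :=
    fun hg => intervalIntegrable_of_integrableOn_Ioo hg (left_mem_Icc.2 hab.le) ht
  rw [← hwa]
  exact gronwall_of_eq_add_integral (y := fun t => ‖w t‖ ^ 2) ht.1 (hint hpair) (hint hk) (hint hf)
    (fun s hs => by
      rw [intervalIntegral.integral_const_mul]
      exact hw_sq s (Icc_subset_Icc_right ht.2 hs))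
    (ae_restrict_of_ae_restrict_of_subset (Ioo_subset_Ioo_right ht.2) hle_w)

section Trilinear

variable {Ω : Set E}

/-- The matrix `(w_i u_j)_{ij}`, as a continuous bilinear map. -/
def outer : E →L[ℝ] E →L[ℝ] Mat :=
  LinearMap.mkContinuous₂
    (LinearMap.mk₂ ℝ (fun w u => WithLp.toLp 2 fun ij : Fin 2 × Fin 2 => w ij.1 * u ij.2)
      (fun _ _ _ => by ext; simp [add_mul]) (fun _ _ _ => by ext; simp [mul_assoc])
      (fun _ _ _ => by ext; simp [mul_add]) (fun _ _ _ => by ext; simp [mul_left_comm]))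
    1 fun w u => by
      refine le_of_sq_le_sq (le_of_eq ?_) (by positivity)
      simp only [LinearMap.mk₂_apply, mul_pow, one_mul, EuclideanSpace.norm_sq_eq, norm_mul,
        Fintype.sum_prod_type, Finset.sum_mul_sum]

lemma outer_apply (w u : E) (ij : Fin 2 × Fin 2) : outer w u ij = w ij.1 * u ij.2 := rfl

lemma norm_outer_le : ‖outer‖ ≤ 1 := LinearMap.mkContinuous₂_norm_le _ zero_le_one _

instance holderTripleFourFourTwo : ENNReal.HolderTriple 4 4 2 where
  inv_add_inv_eq_inv := by
    rw [show (4 : ℝ≥0∞) = 2 * 2 by norm_num, ENNReal.mul_inv (by simp) (by simp), ← mul_add,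
      ENNReal.inv_two_add_inv_two, mul_one]

lemma bForm_congr {u u' w w' : E → E} {G G' : E → Mat} (hu : u =ᵐ[volume.restrict Ω] u')
    (hG : G =ᵐ[volume.restrict Ω] G') (hw : w =ᵐ[volume.restrict Ω] w') :
    bForm Ω u G w = bForm Ω u' G' w' :=
  integral_congr_ae <| by
    filter_upwards [hu, hG, hw] with x h₁ h₂ h₃
    simp only [h₁, h₂, h₃]

lemma bForm_eq_inner (u w : L4 Ω) (G : L2Mat Ω) :
    bForm Ω u G w = inner ℝ (outer.holder 2 w u) G := by
  rw [L2.inner_def]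
  refine integral_congr_ae ?_
  filter_upwards [outer.coeFn_holder (r := 2) w u] with x hx
  simp only [hx, PiLp.inner_apply, Fintype.sum_prod_type, outer_apply, RCLike.inner_apply,
    conj_trivial]
  exact Finset.sum_congr rfl fun i _ => Finset.sum_congr rfl fun j _ => by ring

lemma abs_bForm_le (u w : L4 Ω) (G : L2Mat Ω) : |bForm Ω u G w| ≤ ‖w‖ * ‖u‖ * ‖G‖ := by
  rw [bForm_eq_inner]
  refine (abs_real_inner_le_norm _ _).trans ?_
  gcongr
  refine (outer.norm_holder_apply_apply_le w u).trans ?_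
  rw [mul_assoc]
  exact mul_le_of_le_one_left (by positivity) norm_outer_le

lemma continuous_bForm (u : L4 Ω) :
    Continuous fun x : L4 Ω × L2Mat Ω => bForm Ω u x.2 x.1 := by
  simp only [bForm_eq_inner]
  exact (((outer.holderL (volume.restrict Ω) 4 4 2).flip u).continuous.comp continuous_fst).inner
    continuous_snd

end Trilinear

section Ladyzhenskaya

variable {Ω : Set E} {c : ℝ}

lemma IsLadyzhenskayaConst.memLp (hc : IsLadyzhenskayaConst Ω c) {p : Pair Ω} (hp : p ∈ H10 Ω) :
    MemLp p.fst 4 (volume.restrict Ω) :=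
  ⟨(Lp.memLp p.fst).1, (hc.2 p hp).trans_lt ENNReal.ofReal_lt_top⟩

lemma IsLadyzhenskayaConst.norm_toLp_le (hc : IsLadyzhenskayaConst Ω c) {p : Pair Ω}
    (hp : p ∈ H10 Ω) : ‖(hc.memLp hp).toLp p.fst‖ ≤ √c * √‖p.fst‖ * √‖p.snd‖ := by
  rw [Lp.norm_toLp]
  exact ENNReal.toReal_le_of_le_ofReal (by positivity) (hc.2 p hp)

/-- The embedding of `H¹₀(Ω; ℝ²)` into `L⁴(Ω; ℝ²)`. -/
def IsLadyzhenskayaConst.toL4 (hc : IsLadyzhenskayaConst Ω c) : H10 Ω →L[ℝ] L4 Ω :=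
  LinearMap.mkContinuous
    { toFun := fun p => (hc.memLp p.2).toLp (p : Pair Ω).fst
      map_add' := fun p q => by
        rw [← MemLp.toLp_add]
        exact MemLp.toLp_congr _ _ (Lp.coeFn_add _ _)
      map_smul' := fun r p => by
        rw [RingHom.id_apply, ← MemLp.toLp_const_smul]
        exact MemLp.toLp_congr _ _ (Lp.coeFn_smul _ _) }
    (√c) fun p => by
      refine (hc.norm_toLp_le p.2).trans ?_
      rw [mul_assoc, ← Real.mul_self_sqrt (norm_nonneg p)]
      gcongr
      · exact WithLp.norm_fst_le _ _
      · exact WithLp.norm_snd_le _ _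

lemma IsLadyzhenskayaConst.coeFn_toL4 (hc : IsLadyzhenskayaConst Ω c) (p : H10 Ω) :
    hc.toL4 p =ᵐ[volume.restrict Ω] (p : Pair Ω).fst :=
  (hc.memLp p.2).coeFn_toLp

lemma IsLadyzhenskayaConst.norm_toL4_sq_le (hc : IsLadyzhenskayaConst Ω c) (p : H10 Ω) :
    ‖hc.toL4 p‖ ^ 2 ≤ c * ‖(p : Pair Ω).fst‖ * ‖(p : Pair Ω).snd‖ := calc
  ‖hc.toL4 p‖ ^ 2 ≤ (√c * √‖(p : Pair Ω).fst‖ * √‖(p : Pair Ω).snd‖) ^ 2 := by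
    gcongr
    exact hc.norm_toLp_le p.2
  _ = c * ‖(p : Pair Ω).fst‖ * ‖(p : Pair Ω).snd‖ := by
    rw [mul_pow, mul_pow, Real.sq_sqrt hc.1.le, Real.sq_sqrt (norm_nonneg _),
      Real.sq_sqrt (norm_nonneg _)]

lemma IsLadyzhenskayaConst.abs_bForm_self_le (hc : IsLadyzhenskayaConst Ω c) {p : Pair Ω}
    (hp : p ∈ H10 Ω) (G : L2Mat Ω) :
    |bForm Ω p.fst G p.fst| ≤ c * ‖p.fst‖ * ‖p.snd‖ * ‖G‖ := by
  have hcoe := hc.coeFn_toL4 ⟨p, hp⟩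
  rw [← bForm_congr hcoe .rfl hcoe]
  refine (abs_bForm_le _ _ G).trans ?_
  rw [← sq]
  gcongr
  exact hc.norm_toL4_sq_le ⟨p, hp⟩

lemma IsTest.norm_sq {θ : E → E} (hθ : IsTest Ω θ) : IsTest Ω fun x => ‖θ x‖ ^ 2 := by
  have hsupp : (Function.support fun x => ‖θ x‖ ^ 2) ⊆ Function.support θ := fun x hx hx₀ =>
    hx (by simp [hx₀])
  exact ⟨hθ.1.norm_sq ℝ, hθ.2.1.mono hsupp, (closure_mono hsupp).trans hθ.2.2⟩

lemma pd_norm_sq {θ : E → E} {x : E} (hθ : DifferentiableAt ℝ θ x) (j : Fin 2) :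
    pd j (fun y => ‖θ y‖ ^ 2) x = 2 * ∑ i, grad θ x (i, j) * θ x i := by
  rw [pd, hθ.hasFDerivAt.norm_sq.fderiv]
  simp [PiLp.inner_apply, grad, pd, mul_add]

lemma bForm_grad_self_eq_zero {u : E → E} (hu : IsDivFree Ω u) {θ : E → E} (hθ : IsTest Ω θ) :
    bForm Ω u (grad θ) θ = 0 := by
  have hint : ∀ x, ∑ j, u x j * pd j (fun y => ‖θ y‖ ^ 2) x
      = 2 * ∑ i, ∑ j, u x j * grad θ x (i, j) * θ x i := fun x => by
    simp only [pd_norm_sq (hθ.1.differentiable (by simp) x), Finset.mul_sum]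
    rw [Finset.sum_comm]
    exact Finset.sum_congr rfl fun i _ => Finset.sum_congr rfl fun j _ => by ring
  have hdiv := hu _ hθ.norm_sq
  simp only [hint] at hdiv
  rw [integral_const_mul] at hdiv
  exact (mul_eq_zero_iff_left two_ne_zero).1 hdiv

lemma IsLadyzhenskayaConst.continuousOn_bForm_self (hc : IsLadyzhenskayaConst Ω c) (u : L4 Ω) :
    ContinuousOn (fun p : Pair Ω => bForm Ω u p.snd p.fst) (H10 Ω) := by
  rw [continuousOn_iff_continuous_domRestrict]
  have hsnd : Continuous fun p : H10 Ω => (p : Pair Ω).snd :=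
    ((WithLp.sndL 2 ℝ (L2 Ω) (L2Mat Ω)).comp (H10 Ω).subtypeL).continuous
  exact ((continuous_bForm u).comp (hc.toL4.continuous.prodMk hsnd)).congr fun p =>
    bForm_congr .rfl .rfl (hc.coeFn_toL4 p)

lemma IsLadyzhenskayaConst.bForm_self_eq_zero (hc : IsLadyzhenskayaConst Ω c) {u : L4 Ω}
    (hu : IsDivFree Ω u) {p : Pair Ω} (hp : p ∈ H10 Ω) : bForm Ω u p.snd p.fst = 0 := by
  have hzero : EqOn (fun q : Pair Ω => bForm Ω u q.snd q.fst) 0 (testPairs Ω) :=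
    fun q ⟨θ, hθ, hfst, hsnd⟩ =>
      (bForm_congr .rfl hsnd hfst).trans (bForm_grad_self_eq_zero hu hθ)
  exact hzero.of_subset_closure (hc.continuousOn_bForm_self u) continuousOn_const
    (testPairs Ω).le_topologicalClosure subset_rfl hp

end Ladyzhenskaya

section Energy

variable {Ω : Set E}

lemma ip_eq_inner (f g : L2 Ω) : ip Ω f g = inner ℝ f g := by
  rw [ip, L2.inner_def]
  congr 1 with x
  rw [PiLp.inner_apply]
  exact Finset.sum_congr rfl fun i _ => mul_comm _ _

lemma integral_frobenius_eq_inner (f g : L2Mat Ω) :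
    ∫ x in Ω, ∑ i, ∑ j, f x (i, j) * g x (i, j) = inner ℝ f g := by
  rw [L2.inner_def]
  congr 1 with x
  rw [PiLp.inner_apply, Fintype.sum_prod_type]
  exact Finset.sum_congr rfl fun i _ => Finset.sum_congr rfl fun j _ => mul_comm _ _

lemma le_aForm_self {α : ℝ → ℝ} {φ : E → ℝ} (hα : ∀ᵐ x ∂volume.restrict Ω, 0 ≤ α (φ x)) (μ : ℝ)
    (v : V Ω) : μ * ‖dfld v‖ ^ 2 ≤ aForm Ω μ α φ v v := by
  rw [aForm, integral_frobenius_eq_inner, real_inner_self_eq_norm_sq]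
  refine le_add_of_nonneg_right (integral_nonneg_of_ae ?_)
  filter_upwards [hα] with x hx
  exact mul_nonneg hx (Finset.sum_nonneg fun i _ => mul_self_nonneg _)

lemma two_mul_le_half_mul_sq_add {μ : ℝ} (hμ : 0 < μ) (x g : ℝ) :
    2 * (x * g) ≤ μ / 2 * g ^ 2 + 2 / μ * x ^ 2 := by
  have hsq : μ / 2 * g ^ 2 + 2 / μ * x ^ 2 - 2 * (x * g) = (μ * g - 2 * x) ^ 2 / (2 * μ) := by
    field_simp
    ring
  rw [← sub_nonneg, hsq]
  positivity

lemma energy_inequality {μ cP cL : ℝ} (hμ : 0 < μ) (hcP : IsPoincareConst Ω cP)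
    (hcL : IsLadyzhenskayaConst Ω cL) {α : ℝ → ℝ} {φ : E → ℝ}
    (hα : ∀ᵐ x ∂volume.restrict Ω, 0 ≤ α (φ x)) {G : L2Mat Ω} {u₂ : L4 Ω}
    (hdiv : IsDivFree Ω u₂) {F : L2 Ω} {v : V Ω} {d : ℝ}
    (h : d + aForm Ω μ α φ v v + bForm Ω (fld v) G (fld v) + bForm Ω u₂ (dfld v) (fld v)
      = ip Ω F (fld v)) :
    2 * d ≤ (2 * cL ^ 2 / μ * ‖G‖ ^ 2 - μ / cP ^ 2) * ‖fld v‖ ^ 2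
      + 2 * cP ^ 2 / μ * ‖F‖ ^ 2 := by
  have hP₀ := hcP.1
  have hP : ‖fld v‖ ≤ cP * ‖dfld v‖ := hcP.2 _ v.2.1
  have hdiss : μ / cP ^ 2 * ‖fld v‖ ^ 2 ≤ μ * ‖dfld v‖ ^ 2 := calc
    μ / cP ^ 2 * ‖fld v‖ ^ 2 ≤ μ / cP ^ 2 * (cP * ‖dfld v‖) ^ 2 := by gcongr
    _ = μ * ‖dfld v‖ ^ 2 := by field_simp
  have hconv : |bForm Ω (fld v) G (fld v)| ≤ cL * ‖fld v‖ * ‖dfld v‖ * ‖G‖ :=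
    hcL.abs_bForm_self_le v.2.1 G
  have hforce : ip Ω F (fld v) ≤ cP * ‖F‖ * ‖dfld v‖ := calc
    ip Ω F (fld v) ≤ ‖F‖ * ‖fld v‖ := (ip_eq_inner _ _).trans_le (real_inner_le_norm _ _)
    _ ≤ ‖F‖ * (cP * ‖dfld v‖) := by gcongr
    _ = cP * ‖F‖ * ‖dfld v‖ := by ring
  have hcoer := le_aForm_self hα μ v
  have htransport : bForm Ω u₂ (dfld v) (fld v) = 0 := hcL.bForm_self_eq_zero hdiv v.2.1
  have hyoung_conv := two_mul_le_half_mul_sq_add hμ (cL * ‖fld v‖ * ‖G‖) ‖dfld v‖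
  have hyoung_force := two_mul_le_half_mul_sq_add hμ (cP * ‖F‖) ‖dfld v‖
  calc 2 * d ≤ -(μ / cP ^ 2 * ‖fld v‖ ^ 2) + 2 / μ * (cL * ‖fld v‖ * ‖G‖) ^ 2
        + 2 / μ * (cP * ‖F‖) ^ 2 := by
        linarith [neg_le_of_abs_le hconv]
    _ = _ := by ring

end Energy

section Solution

/-- The divergence `(v, G) ↦ ∑ i, G_{ii}` of a pair standing for a field and its gradient, as a
continuous linear map; `V Ω` is its kernel in `H10 Ω`. -/
def divL (Ω : Set E) : Pair Ω →L[ℝ] Lp ℝ 2 (volume.restrict Ω) :=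
  ((∑ i : Fin 2, EuclideanSpace.proj (i, i) : Mat →L[ℝ] ℝ).compLpL 2 (volume.restrict Ω)).comp
    (WithLp.sndL 2 ℝ (L2 Ω) (L2Mat Ω))

lemma coeFn_divL {Ω : Set E} (p : Pair Ω) :
    divL Ω p =ᵐ[volume.restrict Ω] fun x => ∑ i, p.snd x (i, i) := by
  filter_upwards [ContinuousLinearMap.coeFn_compLpL (p := 2) (μ := volume.restrict Ω)
    (∑ i : Fin 2, EuclideanSpace.proj (i, i) : Mat →L[ℝ] ℝ) p.snd] with x hx
  exact hx.trans (by simp)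

instance completeSpace_V {Ω : Set E} : CompleteSpace (V Ω) := by
  have hV : (V Ω : Set (Pair Ω)) = (H10 Ω : Set (Pair Ω)) ∩ divL Ω ⁻¹' {0} := by
    ext p
    refine and_congr .rfl ?_
    rw [mem_preimage, mem_singleton_iff, Lp.eq_zero_iff_ae_eq_zero]
    exact eventually_congr ((coeFn_divL p).mono fun x hx => by rw [hx, Pi.zero_apply])
  have hclosed : IsClosed (V Ω : Set (Pair Ω)) := hV ▸
    (testPairs Ω).isClosed_topologicalClosure.inter
      (isClosed_singleton.preimage (divL Ω).continuous)
  exact hclosed.completeSpace_coe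

/-- The embedding of `V Ω` into `L2 Ω`, as a continuous linear map. -/
def fldL (Ω : Set E) : V Ω →L[ℝ] L2 Ω :=
  (WithLp.fstL 2 ℝ (L2 Ω) (L2Mat Ω)).comp (V Ω).subtypeL

lemma fldL_apply {Ω : Set E} (v : V Ω) : fldL Ω v = fld v := rfl

lemma IsWeakTimeDeriv.hasGelfandDerivOn {Ω : Set E} {T : ℝ} {u : ℝ → V Ω}
    {u' : ℝ → (V Ω →L[ℝ] ℝ)} (h : IsWeakTimeDeriv Ω T u u') :
    HasGelfandDerivOn (fldL Ω) u u' 0 T := fun ψ η hη => by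
  simpa only [ip_eq_inner, fldL_apply] using h ψ η hη

lemma expA_eq_integral {Ω : Set E} {T t : ℝ} (μ cP cL : ℝ) {z : ℝ → L2 Ω}
    (hz : MemLp z 2 (timeMeas T)) (ht : t ∈ Icc 0 T) :
    expA μ cP cL z t = ∫ τ in (0 : ℝ)..t, (2 * cL ^ 2 / μ * ‖z τ‖ ^ 2 - μ / cP ^ 2) := by
  have hz_sq : IntervalIntegrable (fun τ => ‖z τ‖ ^ 2) volume 0 t :=
    intervalIntegrable_of_integrableOn_Ioo hz.integrable_norm_pow'
      (left_mem_Icc.2 (ht.1.trans ht.2)) ht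
  rw [intervalIntegral.integral_sub (hz_sq.const_mul _) intervalIntegrable_const,
    intervalIntegral.integral_const_mul, intervalIntegral.integral_const, expA]
  simp [mul_comm]

lemma IsPorosity.memLp_top_comp {Ω : Set E} {α : ℝ → ℝ} (hα : IsPorosity α) {φ : E → ℝ}
    (hφ : φ ∈ PhiAd Ω) : MemLp (fun x => α (φ x)) ∞ (volume.restrict Ω) := by
  obtain ⟨⟨_, hφ_mem, _⟩, hφ_le⟩ := hφ
  obtain ⟨K, hK⟩ := hα.lipschitz
  refine memLp_top_of_bound (hK.continuous.comp_aestronglyMeasurable hφ_mem.1) (K * 2) ?_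
  filter_upwards [hφ_le] with x hx
  calc ‖α (φ x)‖ = dist (α (φ x)) (α 1) := by rw [hα.one, dist_zero_right]
    _ ≤ K * dist (φ x) 1 := hK.dist_le_mul _ _
    _ ≤ K * 2 := by
      gcongr
      rw [Real.dist_eq, abs_le]
      constructor <;> linarith [abs_le.1 hx]

end Solution

end LinNS

end

theorem proposition3p1_general {Ω : Set LinNS.E} {T : ℝ} (hT : 0 < T) {μ : ℝ} (hμ : 0 < μ)
    {cP cL : ℝ} (hcP : LinNS.IsPoincareConst Ω cP) (hcL : LinNS.IsLadyzhenskayaConst Ω cL)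
    {α : ℝ → ℝ} {φ : LinNS.E → ℝ} (_hα_mem : MemLp (fun x => α (φ x)) ∞ (volume.restrict Ω))
    (hα : ∀ᵐ x ∂volume.restrict Ω, 0 ≤ α (φ x))
    {F : ℝ → LinNS.L2 Ω} (hF : MemLp F 2 (LinNS.timeMeas T))
    {u₁ u₂ : ℝ → LinNS.L4 Ω} (hdiv : ∀ᵐ t ∂LinNS.timeMeas T, LinNS.IsDivFree Ω (u₂ t))
    {G₁ : ℝ → LinNS.L2Mat Ω}
    (_hG₁ : ∀ᵐ t ∂LinNS.timeMeas T, LinNS.IsWeakGrad Ω (u₁ t) (G₁ t))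
    {z : ℝ → LinNS.L2 Ω} (hz : MemLp z 2 (LinNS.timeMeas T))
    (hbound : ∀ᵐ t ∂LinNS.timeMeas T, ‖G₁ t‖ ^ 2 ≤ ‖z t‖ ^ 2)
    {u₀ : LinNS.L2 Ω} {u : ℝ → LinNS.V Ω}
    (hu : LinNS.IsWeakSolution Ω T μ α φ G₁ u₂ F u₀ u) :
    ∃ w : ℝ → LinNS.L2 Ω,
      ContinuousOn w (Icc 0 T) ∧ (∀ᵐ t ∂LinNS.timeMeas T, w t = LinNS.fld (u t)) ∧ w 0 = u₀ ∧
      ∀ t ∈ Icc 0 T,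
        ‖w t‖ ^ 2 ≤ Real.exp (LinNS.expA μ cP cL z t) * ‖u₀‖ ^ 2
          + 2 * cP ^ 2 / μ * ∫ τ in (0 : ℝ)..t,
              Real.exp (LinNS.expA μ cP cL z t - LinNS.expA μ cP cL z τ) * ‖F τ‖ ^ 2 := by
  obtain ⟨hu_mem, ⟨u', hu'_mem, hderiv, heq⟩, hinit⟩ := hu
  have henergy : ∀ᵐ t ∂LinNS.timeMeas T, 2 * u' t (u t) ≤
      (2 * cL ^ 2 / μ * ‖z t‖ ^ 2 - μ / cP ^ 2) * ‖LinNS.fldL Ω (u t)‖ ^ 2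
        + 2 * cP ^ 2 / μ * ‖F t‖ ^ 2 := by
    filter_upwards [heq, hdiv, hbound] with t heq_t hdiv_t hbound_t
    refine (LinNS.energy_inequality hμ hcP hcL hα hdiv_t (heq_t (u t))).trans ?_
    rw [LinNS.fldL_apply]
    gcongr
  have hk : IntegrableOn (fun t => 2 * cL ^ 2 / μ * ‖z t‖ ^ 2 - μ / cP ^ 2) (Ioo 0 T) :=
    (hz.integrable_norm_pow'.const_mul _).sub (integrable_const _)
  obtain ⟨w, hw, hwu, hw₀, hle⟩ := hderiv.hasGelfandDerivOn.exists_continuousOn_gronwall hT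
    hu_mem hu'_mem hinit hk (hF.integrable_norm_pow'.const_mul _) henergy
  refine ⟨w, hw, hwu, hw₀, fun t ht => (hle t ht).trans_eq ?_⟩
  rw [← LinNS.expA_eq_integral μ cP cL hz ht, ← intervalIntegral.integral_const_mul]
  congr 1
  refine intervalIntegral.integral_congr fun τ hτ => ?_
  rw [uIcc_of_le ht.1] at hτ
  simp only [LinNS.expA_eq_integral μ cP cL hz ⟨hτ.1, hτ.2.trans ht.2⟩]
  ring

theorem proposition3p1
    (Ω : Set LinNS.E) (hΩ : IsOpen Ω)
    (T : ℝ) (hT : 0 < T) (μ : ℝ) (hμ : 0 < μ)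
    (cP cL : ℝ) (hcP : LinNS.IsPoincareConst Ω cP) (hcL : LinNS.IsLadyzhenskayaConst Ω cL)
    (α : ℝ → ℝ) (hα : LinNS.IsPorosity α)
    (φ : LinNS.E → ℝ) (hφ : φ ∈ LinNS.PhiAd Ω)
    (F : ℝ → LinNS.L2 Ω) (hF : MemLp F 2 (LinNS.timeMeas T))
    (u₁ u₂ : ℝ → LinNS.L4 Ω)
    (hu₁ : MemLp u₁ 4 (LinNS.timeMeas T)) (hu₂ : MemLp u₂ 4 (LinNS.timeMeas T))
    (hdiv : ∀ᵐ t ∂(LinNS.timeMeas T), LinNS.IsDivFree Ω (u₂ t))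
    (G₁ : ℝ → LinNS.L2Mat Ω)
    (hG₁ : ∀ᵐ t ∂(LinNS.timeMeas T), LinNS.IsWeakGrad Ω (u₁ t) (G₁ t))
    (z : ℝ → LinNS.L2 Ω) (hz : MemLp z 2 (LinNS.timeMeas T))
    (hbound : ∀ᵐ t ∂(LinNS.timeMeas T), ‖G₁ t‖ ^ 2 ≤ ‖z t‖ ^ 2)
    (u₀ : LinNS.L2 Ω) (hu₀ : LinNS.IsH Ω u₀)
    (u : ℝ → LinNS.V Ω) (hu : LinNS.IsWeakSolution Ω T μ α φ G₁ u₂ F u₀ u) :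
    ∃ w : ℝ → LinNS.L2 Ω,
      ContinuousOn w (Icc 0 T) ∧ (∀ᵐ t ∂(LinNS.timeMeas T), w t = LinNS.fld (u t)) ∧ w 0 = u₀ ∧
      ∀ t ∈ Icc 0 T,
        ‖w t‖ ^ 2 ≤ Real.exp (LinNS.expA μ cP cL z t) * ‖u₀‖ ^ 2
          + 2 * cP ^ 2 / μ * ∫ τ in (0 : ℝ)..t,
              Real.exp (LinNS.expA μ cP cL z t - LinNS.expA μ cP cL z τ) * ‖F τ‖ ^ 2 := by
  exact proposition3p1_general hT hμ hcP hcL (hα.memLp_top_comp hφ)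
    (.of_forall fun _ => hα.nonneg _) hF hdiv hG₁ hz hbound hu
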